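/- Let $m,n\ge 0$ be integers. Trees. A tree of order $n$ is a finite unitrivalent tree with $n$ trivalent vertices (hence $n+2$ univalent vertices), each univalent vertex labelled by an element of $\{1,\dots,m\}$ and each trivalent vertex equipped with a cyclic order of its three edges; trees are taken up to isomorphism. A rooted tree is such a tree with one univalent vertex, the root, left unlabelled; rooted trees correspond to formal non-associative bracketings of the indices $1,\dots,m$, where $(I,J)$ is the rooted tree obtained by joining the roots of $I$ and $J$ to a new rooted edge, with cyclic order $I,J,\text{root}$. For rooted trees $I,J$ let $\langle I,J\rangle$ be the unrooted tree obtained by gluing their rooted edges. Let $\mathcal T_n=\mathcal T_n(m)$ be the free abelian group on the trees of order $n$ modulo the antisymmetry relations AS, $\langle (I,J),K\rangle+\langle (J,I),K\rangle=0$, and the relations IHX, $\langle (A,(B,C)),D\rangle-\langle ((A,B),C),D\rangle+\langle ((A,C),B),D\rangle=0$, for all rooted trees $I,J,K,A,B,C,D$ for which the trees displayed have order $n$. Quasi-Lie algebra. Let $\mathsf L'=\bigoplus_{k\ge1}\mathsf L'_k$ be the free quasi-Lie algebra over $\mathbb Z$ on generators $X_1,\dots,X_m$: the free non-associative $\mathbb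 Z$-algebra modulo the antisymmetry relation $[x,y]=-[y,x]$ and the Jacobi identity (the relation $[x,x]=0$ is not imposed), where $\mathsf L'_k$ is the additive group generated by the length $k$ brackets of generators. Let $\mathsf D'_n$ be the kernel of the bracket map $\mathsf L'_1\otimes_{\mathbb Z}\mathsf L'_{n+1}\to\mathsf L'_{n+2}$, $x\otimes y\mapsto[x,y]$. For a univalent vertex $v$ of a tree $t$ of order $n$, let $\ell(v)$ be its label and let $B_v(t)\in\mathsf L'_{n+1}$ be the bracket of generators determined by the rooted tree obtained from $t$ by considering $v$ as the root. Then $$\eta'_n(t)=\sum_{v} X_{\ell(v)}\otimes B_v(t)\qquad(\text{sum over all univalent vertices } v \text{ of } t)$$ defines a homomorphism $\eta'_n:\mathcal T_n\to\mathsf D'_n$. Theorem (Levine's conjecture). For all $m$ and all $n\ge0$, the map $\eta'_n:\mathcal T_n\to\mathsf D'_n$ is an isomorphism of abelian groups. -/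

import Mathlib

noncomputable section

open scoped TensorProduct

namespace LevineConj

/-! ### Rooted trees and the free quasi-Lie algebra on `m` generators -/

/-- Rooted unitrivalent trees whose non-root univalent vertices are labelled by the `m` indices and
whose trivalent vertices are cyclically ordered. Such trees are the same as formal bracketings of
the indices: `FreeMagma.of i` is the edge joining the root to a vertex labelled `i`, and `I * J` is
the tree `(I, J)` obtained by identifying the roots of `I` and `J` to a single vertex and sprouting
a new rooted edge there, with cyclic order `I`, `J`, root at the new trivalent vertex. -/
abbrev Rooted (m : ℕ) := FreeMagma (Fin m)

/-- The free non-associative algebra over `ℤ` on `m` generators. -/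
abbrev FreeNonAssoc (m : ℕ) := FreeNonUnitalNonAssocAlgebra ℤ (Fin m)

/-- The defining relations of a quasi-Lie algebra: antisymmetry `[a, b] = -[b, a]` (but not
`[a, a] = 0`) and the Jacobi identity. -/
inductive QuasiLieRel (m : ℕ) : FreeNonAssoc m → FreeNonAssoc m → Prop
  | antisymm (a b : FreeNonAssoc m) : QuasiLieRel m (a * b) (-(b * a))
  | jacobi (a b c : FreeNonAssoc m) :
      QuasiLieRel m ((a * b) * c + (b * c) * a + (c * a) * b) 0

/-- The free quasi-Lie algebra `L'` over `ℤ` on `m` generators. Its bracket is written `*`. -/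
def QuasiLie (m : ℕ) : Type := (ringConGen (QuasiLieRel m)).Quotient

instance (m : ℕ) : NonUnitalNonAssocRing (QuasiLie m) :=
  inferInstanceAs (NonUnitalNonAssocRing (ringConGen (QuasiLieRel m)).Quotient)

/-- The quotient map onto the free quasi-Lie algebra. -/
def QuasiLie.mk {m : ℕ} : FreeNonAssoc m →ₙ+* QuasiLie m where
  toFun a := (a : (ringConGen (QuasiLieRel m)).Quotient)
  map_mul' _ _ := rfl
  map_zero' := rfl
  map_add' _ _ := rfl

theorem QuasiLie.mk_surjective {m : ℕ} : Function.Surjective (QuasiLie.mk (m := m)) :=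
  Quotient.mk_surjective

/-- The `i`-th generator `X_i` of `L'`. -/
def gen {m : ℕ} (i : Fin m) : QuasiLie m :=
  QuasiLie.mk (FreeNonUnitalNonAssocAlgebra.of ℤ i)

/-- The bracket of generators of `L'` determined by a formal bracketing of indices. -/
def bracketing {m : ℕ} : Rooted m →ₙ* QuasiLie m := FreeMagma.lift gen

/-- The degree `n` part `L'_n` of `L'`: the additive group generated by length `n` brackets of
generators. -/
def QuasiLieDeg (m n : ℕ) : Submodule ℤ (QuasiLie m) :=
  Submodule.span ℤ {x | ∃ J : Rooted m, J.length = n ∧ bracketing J = x}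

theorem bracketing_mem {m n : ℕ} (J : Rooted m) (h : J.length = n) :
    bracketing J ∈ QuasiLieDeg m n :=
  Submodule.subset_span ⟨J, h, rfl⟩

theorem mul_mem_deg {m k l : ℕ} {x y : QuasiLie m} (hx : x ∈ QuasiLieDeg m k)
    (hy : y ∈ QuasiLieDeg m l) : x * y ∈ QuasiLieDeg m (k + l) := by
  induction hx using Submodule.span_induction with
  | zero => rw [zero_mul]; exact zero_mem _
  | add a b _ _ ha hb => rw [add_mul]; exact add_mem ha hb
  | smul c a _ ha => rw [smul_mul_assoc]; exact Submodule.smul_mem _ c ha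
  | mem a ha =>
    obtain ⟨I, hI, rfl⟩ := ha
    induction hy using Submodule.span_induction with
    | zero => rw [mul_zero]; exact zero_mem _
    | add a b _ _ ha hb => rw [mul_add]; exact add_mem ha hb
    | smul c a _ ha => rw [mul_smul_comm]; exact Submodule.smul_mem _ c ha
    | mem b hb =>
      obtain ⟨J, hJ, rfl⟩ := hb
      rw [← map_mul]
      exact bracketing_mem _ (by rw [← hI, ← hJ]; rfl)

/-- A length `n` formal bracketing as an element of `L'_n`. -/
def bracketingDeg {m n : ℕ} (J : Rooted m) (h : J.length = n) : QuasiLieDeg m n :=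
  ⟨bracketing J, bracketing_mem J h⟩

/-- The bracket map `L'_1 ⊗ L'_{n+1} → L'_{n+2}`, `x ⊗ y ↦ [x, y]`. -/
def bracketMap (m n : ℕ) :
    (QuasiLieDeg m 1 ⊗[ℤ] QuasiLieDeg m (n + 1)) →ₗ[ℤ] QuasiLieDeg m (n + 2) :=
  TensorProduct.lift <| LinearMap.mk₂ ℤ
    (fun x y => ⟨(x : QuasiLie m) * (y : QuasiLie m),
      (by omega : 1 + (n + 1) = n + 2) ▸ mul_mem_deg x.2 y.2⟩)
    (fun _ _ _ => Subtype.ext (add_mul _ _ _))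
    (fun _ _ _ => Subtype.ext (smul_mul_assoc _ _ _))
    (fun _ _ _ => Subtype.ext (mul_add _ _ _))
    (fun _ _ _ => Subtype.ext (mul_smul_comm _ _ _))

/-- `D'_n`, the kernel of the quasi-Lie bracket map. -/
abbrev BracketKernel (m n : ℕ) : Submodule ℤ (QuasiLieDeg m 1 ⊗[ℤ] QuasiLieDeg m (n + 1)) :=
  LinearMap.ker (bracketMap m n)

/-! ### Unrooted trees -/

/-- A pair `(I, J)` of rooted trees encodes the unrooted tree `⟨I, J⟩` (glue `I` and `J` along their
rooted edges) together with a preferred oriented edge, the one resulting from the gluing. Two pairs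
are related by `Rebase` if they encode the same tree with its preferred edge reversed, or moved
across the trivalent vertex at which the trees `I`, `J`, `K` meet in this cyclic order. -/
inductive Rebase (m : ℕ) : Rooted m × Rooted m → Rooted m × Rooted m → Prop
  | flip (I J : Rooted m) : Rebase m (I, J) (J, I)
  | move (I J K : Rooted m) : Rebase m (I * J, K) (J * K, I)

/-- (Isomorphism classes of) unrooted unitrivalent trees whose univalent vertices are labelled by
the `m` indices and whose trivalent vertices are cyclically ordered: such a tree is a pair of
rooted trees, up to the choice of the preferred oriented edge. (Any two oriented edges of a tree
are connected by a sequence of `Rebase` moves.) -/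
def Tree (m : ℕ) : Type := Quot (Rebase m)

/-- The unrooted tree `⟨I, J⟩`, obtained by gluing the rooted edges of `I` and `J` together. -/
def Tree.inner {m : ℕ} (I J : Rooted m) : Tree m := Quot.mk _ (I, J)

/-- The number of trivalent vertices of a rooted tree. -/
def Rooted.order {m : ℕ} : Rooted m → ℕ
  | .of _ => 0
  | .mul I J => Rooted.order I + Rooted.order J + 1

/-- The order of an unrooted tree: its number of trivalent vertices. -/
def Tree.order {m : ℕ} : Tree m → ℕ :=
  Quot.lift (fun p => Rooted.order p.1 + Rooted.order p.2) (by
    rintro _ _ (⟨I, J⟩ | ⟨I, J, K⟩)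
    · exact add_comm _ _
    · change (Rooted.order I + Rooted.order J + 1) + Rooted.order K =
        (Rooted.order J + Rooted.order K + 1) + Rooted.order I
      omega)

/-- All ways of choosing a root in a tree obtained by gluing the rooted edge of `I` to that of `C`,
the root being one of the univalent vertices coming from `I`: for each such vertex `v` the pair
consisting of its label and of the rooted tree obtained by considering `v` as the root. -/
def rootingsIn {m : ℕ} : Rooted m → Rooted m → Multiset (Fin m × Rooted m)
  | .of i, C => {(i, C)}
  | .mul I J, C => rootingsIn I (J * C) + rootingsIn J (C * I)

/-- All ways of choosing a root in an unrooted tree `t`: the multiset, indexed by the univalent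
vertices `v` of `t`, of the pairs (label of `v`, rooted tree obtained from `t` with `v` as root). -/
def Tree.rootings {m : ℕ} : Tree m → Multiset (Fin m × Rooted m) :=
  Quot.lift (fun p => rootingsIn p.1 p.2 + rootingsIn p.2 p.1) (by
    rintro _ _ (⟨I, J⟩ | ⟨I, J, K⟩)
    · exact add_comm _ _
    · change rootingsIn I (J * K) + rootingsIn J (K * I) + rootingsIn K (I * J) =
        rootingsIn J (K * I) + rootingsIn K (I * J) + rootingsIn I (J * K)
      abel)

theorem length_eq_order {m : ℕ} (I : Rooted m) : I.length = Rooted.order I + 1 := by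
  induction I with
  | of i => rfl
  | mul I J hI hJ =>
    change I.length + J.length = Rooted.order I + Rooted.order J + 1 + 1
    omega

theorem length_of_mem_rootingsIn {m : ℕ} (I C : Rooted m) (v : Fin m × Rooted m)
    (hv : v ∈ rootingsIn I C) : v.2.length = Rooted.order I + C.length := by
  induction I generalizing C with
  | of i =>
    have : v = (i, C) := by simpa [rootingsIn] using hv
    subst this
    exact (Nat.zero_add _).symm
  | mul I J hI hJ =>
    have hv' : v ∈ rootingsIn I (J * C) + rootingsIn J (C * I) := hv
    change _ = Rooted.order I + Rooted.order J + 1 + C.length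
    have h1 := length_eq_order I
    have h2 := length_eq_order J
    rcases Multiset.mem_add.1 hv' with h | h
    · have h3 : v.2.length = Rooted.order I + (J.length + C.length) := hI _ h
      omega
    · have h3 : v.2.length = Rooted.order J + (C.length + I.length) := hJ _ h
      omega

/-- Rooting an order `n` tree at a univalent vertex gives a bracketing of length `n + 1`. -/
theorem Tree.length_of_mem_rootings {m n : ℕ} (t : Tree m) (ht : t.order = n)
    (v : Fin m × Rooted m) (hv : v ∈ t.rootings) : v.2.length = n + 1 := by
  induction t using Quot.ind with
  | mk p =>
    obtain ⟨I, J⟩ := p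
    have hv' : v ∈ rootingsIn I J + rootingsIn J I := hv
    have ht' : Rooted.order I + Rooted.order J = n := ht
    have h1 := length_eq_order I
    have h2 := length_eq_order J
    rcases Multiset.mem_add.1 hv' with h | h
    · have := length_of_mem_rootingsIn _ _ _ h
      omega
    · have := length_of_mem_rootingsIn _ _ _ h
      omega

/-! ### The tree group `T_n` and the map `η'_n` -/

/-- The trees of order `n`. -/
abbrev OrderTree (m n : ℕ) := {t : Tree m // t.order = n}

/-- The antisymmetry and IHX relators in the free abelian group on order `n` trees. Since the
preferred edge of `⟨I, J⟩` can be any edge, `as` reverses the cyclic order at an arbitrary trivalent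
vertex, and `ihx` is the relation `I - H + X = 0` at an arbitrary edge between trivalent vertices,
with `A`, `B`, `C`, `D` the four subtrees around that edge. -/
inductive Relator (m n : ℕ) : FreeAbelianGroup (OrderTree m n) → Prop
  | as (I J K : Rooted m) (h : (Tree.inner (I * J) K).order = n)
      (h' : (Tree.inner (J * I) K).order = n) :
      Relator m n (.of ⟨.inner (I * J) K, h⟩ + .of ⟨.inner (J * I) K, h'⟩)
  | ihx (A B C D : Rooted m) (hI : (Tree.inner (A * (B * C)) D).order = n)
      (hH : (Tree.inner ((A * B) * C) D).order = n)
      (hX : (Tree.inner ((A * C) * B) D).order = n) :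
      Relator m n (.of ⟨.inner (A * (B * C)) D, hI⟩ - .of ⟨.inner ((A * B) * C) D, hH⟩
        + .of ⟨.inner ((A * C) * B) D, hX⟩)

/-- The tree group `T_n`: the free abelian group on order `n` trees modulo AS and IHX. -/
abbrev TreeGroup (m n : ℕ) : Type :=
  FreeAbelianGroup (OrderTree m n) ⧸ AddSubgroup.closure {x | Relator m n x}

/-- The sum over all univalent vertices `v` of `t` of `X_{ℓ(v)} ⊗ B_v(t)`, where `ℓ(v)` is the label
of `v` and `B_v(t)` is the bracket obtained by considering `v` as the root of `t`. -/
def etaTree {m n : ℕ} (t : OrderTree m n) : QuasiLieDeg m 1 ⊗[ℤ] QuasiLieDeg m (n + 1) :=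
  (t.1.rootings.pmap
    (fun v (h : v.2.length = n + 1) =>
      bracketingDeg (FreeMagma.of v.1) rfl ⊗ₜ[ℤ] bracketingDeg v.2 h)
    (t.1.length_of_mem_rootings t.2)).sum

theorem mul_antisymm {m : ℕ} (x y : QuasiLie m) : x * y = -(y * x) := by
  obtain ⟨a, rfl⟩ := QuasiLie.mk_surjective x
  obtain ⟨b, rfl⟩ := QuasiLie.mk_surjective y
  exact (RingCon.eq _).2 (RingConGen.Rel.of _ _ (QuasiLieRel.antisymm a b))

theorem jacobi {m : ℕ} (x y z : QuasiLie m) :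
    (x * y) * z + (y * z) * x + (z * x) * y = 0 := by
  obtain ⟨a, rfl⟩ := QuasiLie.mk_surjective x
  obtain ⟨b, rfl⟩ := QuasiLie.mk_surjective y
  obtain ⟨c, rfl⟩ := QuasiLie.mk_surjective z
  exact (RingCon.eq _).2 (RingConGen.Rel.of _ _ (QuasiLieRel.jacobi a b c))

/-! The remaining facts show that `etaTree` takes values in `D'_n` and respects AS and IHX. -/

open Classical in
/-- Auxiliary: `X_i ⊗ y` for `y` of degree `n + 1`. -/
def tmulAux {m : ℕ} (n : ℕ) (i : Fin m) (y : QuasiLie m) :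
    QuasiLieDeg m 1 ⊗[ℤ] QuasiLieDeg m (n + 1) :=
  if h : y ∈ QuasiLieDeg m (n + 1) then bracketingDeg (FreeMagma.of i) rfl ⊗ₜ[ℤ] ⟨y, h⟩ else 0

/-- Auxiliary: the part of the sum over roots coming from the subtree `I`. -/
def etaAux {m : ℕ} (n : ℕ) : Rooted m → QuasiLie m →
    QuasiLieDeg m 1 ⊗[ℤ] QuasiLieDeg m (n + 1)
  | .of i, c => tmulAux n i c
  | .mul I J, c => etaAux n I (bracketing J * c) + etaAux n J (c * bracketing I)

theorem etaAux_mul {m : ℕ} (n : ℕ) (I J : Rooted m) (c : QuasiLie m) :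
    etaAux n (I * J) c = etaAux n I (bracketing J * c) + etaAux n J (c * bracketing I) := rfl

theorem map_rootingsIn {m : ℕ} (n : ℕ) (I C : Rooted m) :
    ((rootingsIn I C).map fun v => tmulAux n v.1 (bracketing v.2)).sum =
      etaAux n I (bracketing C) := by
  induction I generalizing C with
  | of i => exact Multiset.sum_singleton _
  | mul I J hI hJ =>
    change ((rootingsIn I (J * C) + rootingsIn J (C * I)).map _).sum = _
    rw [Multiset.map_add, Multiset.sum_add, hI, hJ, map_mul, map_mul]
    rfl

theorem etaTree_eq {m n : ℕ} (I J : Rooted m) (h : (Tree.inner I J).order = n) :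
    etaTree ⟨.inner I J, h⟩ = etaAux n I (bracketing J) + etaAux n J (bracketing I) := by
  rw [← map_rootingsIn, ← map_rootingsIn, ← Multiset.sum_add, ← Multiset.map_add, etaTree]
  change _ = (Multiset.map _ (Tree.inner I J).rootings).sum
  rw [← Multiset.pmap_eq_map _ _ _ (Tree.length_of_mem_rootings _ h)]
  congr 1
  refine Multiset.pmap_congr _ fun v _ h1 _ => ?_
  rw [tmulAux, dif_pos (bracketing_mem _ h1)]
  rfl

theorem etaAux_add {m n : ℕ} (I : Rooted m) {k : ℕ} (hk : Rooted.order I + k = n + 1)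
    {c d : QuasiLie m} (hc : c ∈ QuasiLieDeg m k) (hd : d ∈ QuasiLieDeg m k) :
    etaAux n I (c + d) = etaAux n I c + etaAux n I d := by
  induction I generalizing k c d with
  | of i =>
    obtain rfl : k = n + 1 := by rw [← hk]; exact (Nat.zero_add k).symm
    change tmulAux n i _ = tmulAux n i _ + tmulAux n i _
    rw [tmulAux, tmulAux, tmulAux, dif_pos hc, dif_pos hd, dif_pos (add_mem hc hd),
      ← TensorProduct.tmul_add]
    rfl
  | mul I J hI hJ =>
    change Rooted.order I + Rooted.order J + 1 + k = n + 1 at hk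
    have h1 := length_eq_order I
    have h2 := length_eq_order J
    have e1 := hI (k := J.length + k) (by omega) (mul_mem_deg (bracketing_mem J rfl) hc)
      (mul_mem_deg (bracketing_mem J rfl) hd)
    have e2 := hJ (k := k + I.length) (by omega) (mul_mem_deg hc (bracketing_mem I rfl))
      (mul_mem_deg hd (bracketing_mem I rfl))
    change etaAux n (I * J) _ = etaAux n (I * J) _ + etaAux n (I * J) _
    rw [etaAux_mul, etaAux_mul, etaAux_mul, mul_add, add_mul, e1, e2]
    abel

theorem etaAux_zero {m n : ℕ} (I : Rooted m) (h : Rooted.order I ≤ n + 1) :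
    etaAux n I 0 = 0 := by
  have := etaAux_add (n := n) I (k := n + 1 - Rooted.order I) (by omega) (zero_mem _) (zero_mem _)
  rw [add_zero] at this
  exact left_eq_add.1 this

theorem bracketMap_etaAux {m n : ℕ} (I : Rooted m) {k : ℕ} (hk : Rooted.order I + k = n + 1)
    {c : QuasiLie m} (hc : c ∈ QuasiLieDeg m k) :
    (bracketMap m n (etaAux n I c) : QuasiLie m) = bracketing I * c := by
  induction I generalizing k c with
  | of i =>
    obtain rfl : k = n + 1 := by rw [← hk]; exact (Nat.zero_add k).symm
    change (bracketMap m n (tmulAux n i c) : QuasiLie m) = _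
    rw [tmulAux, dif_pos hc]
    rfl
  | mul I J hI hJ =>
    change Rooted.order I + Rooted.order J + 1 + k = n + 1 at hk
    have h1 := length_eq_order I
    have h2 := length_eq_order J
    change (bracketMap m n (etaAux n (I * J) c) : QuasiLie m) = bracketing (I * J) * c
    rw [etaAux_mul, map_add, Submodule.coe_add,
      hI (k := J.length + k) (by omega) (mul_mem_deg (bracketing_mem J rfl) hc),
      hJ (k := k + I.length) (by omega) (mul_mem_deg hc (bracketing_mem I rfl)), map_mul]
    have h3 := jacobi (bracketing I) (bracketing J) c
    rw [mul_antisymm (bracketing I) (bracketing J * c),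
      mul_antisymm (bracketing J) (c * bracketing I), eq_comm, ← sub_eq_zero, ← h3]
    abel

theorem etaTree_inner_mem {m n : ℕ} (I J : Rooted m) (h : (Tree.inner I J).order = n) :
    etaTree ⟨.inner I J, h⟩ ∈ BracketKernel m n := by
  have h' : Rooted.order I + Rooted.order J = n := h
  have h1 := length_eq_order I
  have h2 := length_eq_order J
  rw [LinearMap.mem_ker, etaTree_eq, map_add]
  apply Subtype.ext
  rw [Submodule.coe_add, bracketMap_etaAux I (by omega) (bracketing_mem J rfl),
    bracketMap_etaAux J (by omega) (bracketing_mem I rfl), mul_antisymm]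
  exact neg_add_cancel _

theorem etaTree_mem {m n : ℕ} (t : OrderTree m n) : etaTree t ∈ BracketKernel m n := by
  obtain ⟨⟨I, J⟩, h⟩ := t
  exact etaTree_inner_mem I J h

/-- The sum over all choices of root, extended linearly to the free abelian group on trees. -/
def etaFree (m n : ℕ) : FreeAbelianGroup (OrderTree m n) →+ BracketKernel m n :=
  FreeAbelianGroup.lift fun t => ⟨etaTree t, etaTree_mem t⟩

theorem etaAux_antisymm {m n : ℕ} (I J K : Rooted m)
    (h : Rooted.order I + Rooted.order J + Rooted.order K + 1 = n) :
    etaAux n I (bracketing J * bracketing K) + etaAux n I (bracketing K * bracketing J) = 0 := by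
  have h2 := length_eq_order J
  have h3 := length_eq_order K
  have hm := mul_mem_deg (bracketing_mem J rfl) (bracketing_mem K rfl)
  rw [mul_antisymm (bracketing K), ← etaAux_add I (by omega) hm (neg_mem hm), add_neg_cancel]
  exact etaAux_zero I (by omega)

theorem etaAux_jacobi {m n : ℕ} (I : Rooted m) {k : ℕ} (hk : Rooted.order I + k = n + 1)
    {x y z : QuasiLie m} (hx : x ∈ QuasiLieDeg m k)
    (hz : z ∈ QuasiLieDeg m k) (h : x - y + z = 0) :
    etaAux n I x - etaAux n I y + etaAux n I z = 0 := by
  have e := etaAux_add I hk hx hz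
  rw [show x + z = y by rw [← sub_eq_zero, ← h]; abel] at e
  rw [e]
  abel

theorem ihx_base {m : ℕ} (x y z : QuasiLie m) :
    x * (y * z) - (x * y) * z + (x * z) * y = 0 := by
  rw [mul_antisymm x (y * z), mul_antisymm x z, neg_mul, ← neg_eq_zero, ← jacobi x y z]
  abel

theorem ihx_left {m : ℕ} (x y z : QuasiLie m) :
    (x * y) * z - x * (y * z) + y * (x * z) = 0 := by
  rw [mul_antisymm y (x * z), ← neg_eq_zero, ← ihx_base x y z]
  abel

theorem ihx_mid {m : ℕ} (x y z : QuasiLie m) :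
    x * (y * z) - (x * y) * z + y * (z * x) = 0 := by
  rw [mul_antisymm y (z * x), mul_antisymm z x, neg_mul, neg_neg]
  exact ihx_base x y z

theorem ihx_right {m : ℕ} (x y z : QuasiLie m) :
    (x * y) * z - x * (y * z) + (z * x) * y = 0 := by
  rw [mul_antisymm z x, neg_mul, ← neg_eq_zero, ← ihx_base x y z]
  abel

theorem etaFree_relator {m n : ℕ} {x : FreeAbelianGroup (OrderTree m n)} (hx : Relator m n x) :
    etaFree m n x = 0 := by
  apply Subtype.ext
  cases hx with
  | as I J K h h' =>
    rw [map_add, etaFree, FreeAbelianGroup.lift_apply_of, FreeAbelianGroup.lift_apply_of]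
    change etaTree _ + etaTree _ = 0
    have ho : Rooted.order I + Rooted.order J + 1 + Rooted.order K = n := h
    rw [etaTree_eq, etaTree_eq, etaAux_mul, etaAux_mul, map_mul, map_mul]
    have e1 := etaAux_antisymm (n := n) I J K (by omega)
    have e2 := etaAux_antisymm (n := n) J K I (by omega)
    have e3 := etaAux_antisymm (n := n) K I J (by omega)
    have e := congrArg₂ (· + ·) (congrArg₂ (· + ·) e1 e2) e3
    simp only [add_zero] at e
    rw [← e]
    abel
  | ihx A B C D hI hH hX =>
    rw [map_add, map_sub, etaFree, FreeAbelianGroup.lift_apply_of, FreeAbelianGroup.lift_apply_of,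
      FreeAbelianGroup.lift_apply_of]
    change etaTree _ - etaTree _ + etaTree _ = 0
    have ho : Rooted.order A + (Rooted.order B + Rooted.order C + 1) + 1 + Rooted.order D = n := hI
    have hA := length_eq_order A
    have hB := length_eq_order B
    have hC := length_eq_order C
    have hD := length_eq_order D
    rw [etaTree_eq, etaTree_eq, etaTree_eq]
    simp only [etaAux_mul, map_mul]
    have l (X Y Z : Rooted m) {k : ℕ} (h : X.length + Y.length + Z.length = k) :
        (bracketing X * bracketing Y) * bracketing Z ∈ QuasiLieDeg m k :=
      h ▸ mul_mem_deg (mul_mem_deg (bracketing_mem X rfl) (bracketing_mem Y rfl))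
        (bracketing_mem Z rfl)
    have r (X Y Z : Rooted m) {k : ℕ} (h : X.length + (Y.length + Z.length) = k) :
        bracketing X * (bracketing Y * bracketing Z) ∈ QuasiLieDeg m k :=
      h ▸ mul_mem_deg (bracketing_mem X rfl)
        (mul_mem_deg (bracketing_mem Y rfl) (bracketing_mem Z rfl))
    have e1 := etaAux_jacobi (n := n) A (k := n + 1 - Rooted.order A) (by omega)
      (l B C D (by omega)) (r C B D (by omega)) (ihx_left _ _ _)
    have e2 := etaAux_jacobi (n := n) B (k := n + 1 - Rooted.order B) (by omega)
      (r C D A (by omega)) (r D A C (by omega)) (ihx_mid _ _ _)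
    have e3 := etaAux_jacobi (n := n) C (k := n + 1 - Rooted.order C) (by omega)
      (l D A B (by omega)) (l B D A (by omega)) (ihx_right _ _ _)
    have e4 := etaAux_jacobi (n := n) D (k := n + 1 - Rooted.order D) (by omega)
      (r A B C (by omega)) (l A C B (by omega)) (ihx_base _ _ _)
    have e := congrArg₂ (· + ·) (congrArg₂ (· + ·) (congrArg₂ (· + ·) e1 e2) e3) e4
    simp only [add_zero] at e
    rw [← e]
    abel

/-- Levine's map `η'_n : T_n → D'_n`, the sum over all choices of root. -/
def etaPrime (m n : ℕ) : TreeGroup m n →+ BracketKernel m n :=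
  QuotientAddGroup.lift _ (etaFree m n) <| by
    rw [AddSubgroup.closure_le]
    exact fun x hx => etaFree_relator hx

theorem etaPrime_of {m n : ℕ} (t : OrderTree m n) :
    (etaPrime m n (QuotientAddGroup.mk (.of t)) : QuasiLieDeg m 1 ⊗[ℤ] QuasiLieDeg m (n + 1)) =
      etaTree t := by
  change (etaFree m n (.of t)).1 = _
  rw [etaFree, FreeAbelianGroup.lift_apply_of]

end LevineConj
end

noncomputable section
open scoped TensorProduct
namespace LevineConj

/-! Trees modulo AS and IHX are the values of the universal symmetric invariant form on `L'`: moving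
the preferred edge is symmetry and invariance, while AS and IHX are antisymmetry and Jacobi in one
argument (`isTreeForm_form`, `treeFormLift`). With this form group in place of the tree groups, the
theorem says that the sum over roots `eta` is injective and that its image is the kernel of the
bracket map `legBr : ℤ^α ⊗ L' → L'`. This is proved in all degrees at once and for every alphabet;
gradings then isolate one order.

Exactness in the middle (`exists_eta_eq`) is formal. The group `ℤ^α ⊕ coker eta` carries a quasi-Lie
bracket, because antisymmetry and Jacobi hold there precisely modulo the image of `eta`. The
universal property of `L'` gives a map from `L'` to this group which sends `legBr z` to the class of
`z`. Hence `legBr z = 0` puts `z` in the image of `eta`.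

Injectivity is an induction on the number of leaves, over all alphabets simultaneously, by
elimination of a letter `x`. The words `[x, [x, ..., [x, y]]]` with `y ≠ x` generate a free
quasi-Lie subalgebra (`subst_injective`), on which bracketing with `x` is a derivation shifting
words. If the image of a tree combination `t` in words is killed by `eta`, exactness gives `s` such
that `t` and the derivative of `s` have the same `eta` (`exists_eta_formDer`). A tree in which `x`
occurs has fewer words than letters as leaves, so induction identifies `t` with such a derivative,
and derivatives vanish after substitution by invariance of the form (`formMap_formDer`). Trees not
expressible in words are reduced to `⟨x, a⟩` and `⟨[x, x], a⟩`; these are detected by the one-letter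
algebra `ℤ ⊕ ℤ/2` (`eq_zero_of_mem_treeSpan`). Thus an element of `ker eta` is unchanged when any
letter is set to zero. As it involves finitely many letters, it vanishes (`formProj_eq_zero`). -/

/-! ### The free quasi-Lie algebra on an arbitrary alphabet -/

/-- The defining relations of a quasi-Lie algebra, over an arbitrary alphabet. -/
inductive FreeQuasiLieRel (α : Type) :
    FreeNonUnitalNonAssocAlgebra ℤ α → FreeNonUnitalNonAssocAlgebra ℤ α → Prop
  | antisymm (a b : FreeNonUnitalNonAssocAlgebra ℤ α) : FreeQuasiLieRel α (a * b) (-(b * a))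
  | jacobi (a b c : FreeNonUnitalNonAssocAlgebra ℤ α) :
      FreeQuasiLieRel α ((a * b) * c + (b * c) * a + (c * a) * b) 0

/-- The free quasi-Lie algebra over `ℤ` on the alphabet `α`. -/
def FreeQuasiLie (α : Type) : Type := (ringConGen (FreeQuasiLieRel α)).Quotient

instance (α : Type) : NonUnitalNonAssocRing (FreeQuasiLie α) :=
  inferInstanceAs (NonUnitalNonAssocRing (ringConGen (FreeQuasiLieRel α)).Quotient)

/-- Biadditive brackets satisfying antisymmetry and the Jacobi identity. -/
structure IsQuasiLieBracket {G : Type*} [AddCommGroup G] (m : G → G → G) : Prop where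
  add_left : ∀ a b c, m (a + b) c = m a c + m b c
  antisymm : ∀ a b, m a b = -m b a
  jacobi : ∀ a b c, m (m a b) c + m (m b c) a + m (m c a) b = 0

theorem IsQuasiLieBracket.add_right {G : Type*} [AddCommGroup G] {m : G → G → G}
    (h : IsQuasiLieBracket m) (a b c : G) : m a (b + c) = m a b + m a c := by
  rw [h.antisymm, h.add_left, h.antisymm a b, h.antisymm a c]
  abel

theorem IsQuasiLieBracket.zero_left {G : Type*} [AddCommGroup G] {m : G → G → G}
    (h : IsQuasiLieBracket m) (a : G) : m 0 a = 0 := by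
  have := h.add_left 0 0 a
  rwa [add_zero, left_eq_add] at this

theorem IsQuasiLieBracket.zero_right {G : Type*} [AddCommGroup G] {m : G → G → G}
    (h : IsQuasiLieBracket m) (a : G) : m a 0 = 0 := by
  rw [h.antisymm, h.zero_left, neg_zero]

/-- The non-associative ring structure defined by a quasi-Lie bracket. -/
abbrev IsQuasiLieBracket.ring {G : Type*} [inst : AddCommGroup G] {m : G → G → G}
    (h : IsQuasiLieBracket m) : NonUnitalNonAssocRing G :=
  { inst with
    mul := m
    left_distrib := h.add_right
    right_distrib := h.add_left
    zero_mul := h.zero_left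
    mul_zero := h.zero_right }

/-- Additive maps preserving products descend to the quotient by the generated congruence. -/
def quotientLift {A G : Type*} [NonUnitalNonAssocRing A] [AddCommGroup G] {m : G → G → G}
    (r : A → A → Prop) (f : A →+ G)
    (hm : ∀ a b, f (a * b) = m (f a) (f b)) (hr : ∀ a b, r a b → f a = f b) :
    (ringConGen r).Quotient →+ G :=
  AddMonoidHom.mk' (Quotient.lift f fun a b hab => by
    change RingConGen.Rel r a b at hab
    induction hab with
    | of x y h => exact hr _ _ h
    | refl x => rfl
    | symm _ ih => exact ih.symm
    | trans _ _ ih1 ih2 => exact ih1.trans ih2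
    | add _ _ ih1 ih2 => rw [map_add, map_add, ih1, ih2]
    | mul _ _ ih1 ih2 => rw [hm, hm, ih1, ih2])
    (by rintro ⟨a⟩ ⟨b⟩; exact map_add f a b)

namespace FreeQuasiLie

variable {α : Type}

/-- The quotient map onto the free quasi-Lie algebra. -/
def mk : FreeNonUnitalNonAssocAlgebra ℤ α →ₙ+* FreeQuasiLie α where
  toFun a := (a : (ringConGen (FreeQuasiLieRel α)).Quotient)
  map_mul' _ _ := rfl
  map_zero' := rfl
  map_add' _ _ := rfl

theorem mk_surjective : Function.Surjective (mk (α := α)) := Quotient.mk_surjective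

/-- The generators of the free quasi-Lie algebra. -/
def of (a : α) : FreeQuasiLie α := mk (FreeNonUnitalNonAssocAlgebra.of ℤ a)

theorem antisymm (x y : FreeQuasiLie α) : x * y = -(y * x) := by
  obtain ⟨a, rfl⟩ := mk_surjective x
  obtain ⟨b, rfl⟩ := mk_surjective y
  exact (RingCon.eq _).2 (RingConGen.Rel.of _ _ (FreeQuasiLieRel.antisymm a b))

theorem jacobi (x y z : FreeQuasiLie α) : (x * y) * z + (y * z) * x + (z * x) * y = 0 := by
  obtain ⟨a, rfl⟩ := mk_surjective x
  obtain ⟨b, rfl⟩ := mk_surjective y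
  obtain ⟨c, rfl⟩ := mk_surjective z
  exact (RingCon.eq _).2 (RingConGen.Rel.of _ _ (FreeQuasiLieRel.jacobi a b c))

theorem isQuasiLieBracket : IsQuasiLieBracket fun x y : FreeQuasiLie α => x * y :=
  ⟨add_mul, antisymm, jacobi⟩

/-- The bracket of generators determined by a formal bracketing. -/
def br : FreeMagma α →ₙ* FreeQuasiLie α := FreeMagma.lift of

@[simp] theorem br_of (a : α) : br (FreeMagma.of a) = of a := rfl

theorem mk_single (I : FreeMagma α) (n : ℤ) : mk (MonoidAlgebra.single I n) = n • br I := by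
  have h : mk (MonoidAlgebra.single I (1 : ℤ)) = br I := by
    induction I with
    | ih1 a => rfl
    | ih2 I J hI hJ =>
      rw [map_mul, ← hI, ← hJ, ← map_mul, MonoidAlgebra.single_mul_single, mul_one]
  rw [← h, ← map_zsmul, MonoidAlgebra.smul_single, smul_eq_mul, mul_one]

theorem mem_closure_br (q : FreeQuasiLie α) :
    q ∈ AddSubgroup.closure (Set.range (br : FreeMagma α → FreeQuasiLie α)) := by
  obtain ⟨a, rfl⟩ := mk_surjective q
  induction a using MonoidAlgebra.induction_linear with
  | zero => rw [map_zero]; exact zero_mem _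
  | add f g hf hg => rw [map_add]; exact add_mem hf hg
  | single I n =>
    rw [mk_single]
    exact zsmul_mem (AddSubgroup.subset_closure (Set.mem_range_self I)) n

theorem addHom_ext {G : Type*} [AddCommGroup G] {f g : FreeQuasiLie α →+ G}
    (h : ∀ I, f (br I) = g (br I)) : f = g := by
  refine DFunLike.ext _ _ fun q => ?_
  have hq := mem_closure_br q
  induction hq using AddSubgroup.closure_induction with
  | mem _ hx => obtain ⟨I, rfl⟩ := hx; exact h I
  | zero => rw [map_zero, map_zero]
  | add _ _ _ _ h1 h2 => rw [map_add, map_add, h1, h2]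
  | neg _ _ h1 => rw [map_neg, map_neg, h1]

@[elab_as_elim]
theorem induction {p : FreeQuasiLie α → Prop} (q : FreeQuasiLie α) (of : ∀ a, p (of a))
    (zero : p 0) (add : ∀ x y, p x → p y → p (x + y)) (neg : ∀ x, p x → p (-x))
    (mul : ∀ x y, p x → p y → p (x * y)) : p q := by
  induction mem_closure_br q using AddSubgroup.closure_induction with
  | mem _ hx =>
    obtain ⟨I, rfl⟩ := hx
    induction I with
    | ih1 a => exact of a
    | ih2 I J hI hJ => rw [map_mul]; exact mul _ _ hI hJ
  | zero => exact zero
  | add _ _ _ _ h1 h2 => exact add _ _ h1 h2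
  | neg _ _ h1 => exact neg _ h1

section lift

variable {G : Type*} [AddCommGroup G] {m : G → G → G}

/-- The universal property of the free quasi-Lie algebra. -/
def lift (h : IsQuasiLieBracket m) (f : α → G) : FreeQuasiLie α →+ G :=
  letI := h.ring
  quotientLift (m := m) (FreeQuasiLieRel α)
    (FreeNonUnitalNonAssocAlgebra.lift ℤ f : FreeNonUnitalNonAssocAlgebra ℤ α →+ G)
    (fun a b => map_mul (FreeNonUnitalNonAssocAlgebra.lift ℤ f) a b) (by
      have hmul : ∀ x y : G, x * y = m x y := fun _ _ => rfl
      rintro _ _ (⟨a, b⟩ | ⟨a, b, c⟩)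
      · simp only [AddMonoidHom.coe_coe, map_mul, map_neg, hmul]
        exact h.antisymm _ _
      · simp only [AddMonoidHom.coe_coe, map_mul, map_add, map_zero, hmul]
        exact h.jacobi _ _ _)

@[simp] theorem lift_of (h : IsQuasiLieBracket m) (f : α → G) (a : α) : lift h f (of a) = f a :=
  let := h.ring
  FreeNonUnitalNonAssocAlgebra.lift_of_apply (R := ℤ) f a

@[simp] theorem lift_mul (h : IsQuasiLieBracket m) (f : α → G) (x y : FreeQuasiLie α) :
    lift h f (x * y) = m (lift h f x) (lift h f y) := by
  let := h.ring
  obtain ⟨a, rfl⟩ := mk_surjective x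
  obtain ⟨b, rfl⟩ := mk_surjective y
  exact map_mul (FreeNonUnitalNonAssocAlgebra.lift ℤ f) a b

end lift

/-- The homomorphism of quasi-Lie algebras extending a map of generators. -/
def hom {β : Type} (f : α → FreeQuasiLie β) : FreeQuasiLie α →+ FreeQuasiLie β :=
  lift isQuasiLieBracket f

@[simp] theorem hom_of {β : Type} (f : α → FreeQuasiLie β) (a : α) : hom f (of a) = f a :=
  lift_of _ _ _

@[simp] theorem hom_mul {β : Type} (f : α → FreeQuasiLie β) (x y : FreeQuasiLie α) :
    hom f (x * y) = hom f x * hom f y :=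
  lift_mul _ _ _ _

/-- The bracket of a square with anything vanishes. -/
theorem sq_mul (x y : FreeQuasiLie α) : (x * x) * y = 0 := by
  have := jacobi x x y
  rwa [antisymm (y * x) x, antisymm y x, mul_neg, neg_neg, antisymm x (x * y),
    add_neg_cancel_right] at this

theorem mul_sq (x y : FreeQuasiLie α) : y * (x * x) = 0 := by
  rw [antisymm, sq_mul, neg_zero]

theorem sq_add_sq (x : FreeQuasiLie α) : x * x + x * x = 0 := by
  nth_rw 1 [antisymm x x]
  exact neg_add_cancel _

end FreeQuasiLie

/-! ### Sums over the leaves, the universal invariant form and the map `η` -/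

namespace FreeQuasiLie

variable {α : Type}

/-- The additive group `ℤ^α ⊗ L'`. -/
abbrev Legs (α : Type) : Type := α →₀ FreeQuasiLie α

/-- Jacobi in the shape met when a fixed leaf becomes the root and the cyclic order is read off from
it. -/
theorem rotate_cancel (b c d : FreeQuasiLie α) :
    b * (c * d) + d * (b * c) + (b * d) * c = 0 := by
  rw [antisymm b (c * d), antisymm d (b * c), antisymm b d, neg_mul, ← neg_eq_zero,
    ← jacobi b c d]
  abel

/-- The bracket on `L' × Hom(L', ℤ^α ⊗ L')` governing sums over the leaves of a bracketing. -/
def legBracket (x y : FreeQuasiLie α × (FreeQuasiLie α →+ Legs α)) :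
    FreeQuasiLie α × (FreeQuasiLie α →+ Legs α) :=
  (x.1 * y.1, x.2.comp (AddMonoidHom.mulLeft y.1) + y.2.comp (AddMonoidHom.mulRight x.1))

/-- This makes leaf sums well defined on `L'` rather than on bracketings. For Jacobi the nine leaf
terms are grouped by the factor carrying the leaf, and each group cancels by `rotate_cancel`. -/
theorem isQuasiLieBracket_legBracket : IsQuasiLieBracket (legBracket (α := α)) where
  add_left x y z := by
    refine Prod.ext (add_mul _ _ _) (AddMonoidHom.ext fun c => ?_)
    simp only [legBracket, Prod.fst_add, Prod.snd_add, AddMonoidHom.add_apply,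
      AddMonoidHom.comp_apply, AddMonoidHom.coe_mulLeft, AddMonoidHom.coe_mulRight, mul_add,
      map_add]
    abel
  antisymm x y := by
    refine Prod.ext (FreeQuasiLie.antisymm _ _) (AddMonoidHom.ext fun c => ?_)
    simp only [legBracket, Prod.snd_neg, AddMonoidHom.add_apply, AddMonoidHom.neg_apply,
      AddMonoidHom.comp_apply, AddMonoidHom.coe_mulLeft, AddMonoidHom.coe_mulRight]
    rw [FreeQuasiLie.antisymm y.1 c, FreeQuasiLie.antisymm c x.1, map_neg, map_neg]
    abel
  jacobi x y z := by
    refine Prod.ext (FreeQuasiLie.jacobi _ _ _) (AddMonoidHom.ext fun d => ?_)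
    simp only [legBracket, Prod.snd_add, AddMonoidHom.add_apply, Prod.snd_zero,
      AddMonoidHom.zero_apply,
      AddMonoidHom.comp_apply, AddMonoidHom.coe_mulLeft, AddMonoidHom.coe_mulRight]
    have h (a b c : FreeQuasiLie α × (FreeQuasiLie α →+ Legs α)) :
        a.2 (b.1 * (c.1 * d)) + a.2 (d * (b.1 * c.1)) + a.2 ((b.1 * d) * c.1) = 0 := by
      rw [← map_add, ← map_add, rotate_cancel, map_zero]
    have e := congrArg₂ (· + ·) (congrArg₂ (· + ·) (h x y z) (h y z x)) (h z x y)
    simp only [add_zero] at e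
    rw [← e]
    abel

/-- The sum over the leaves of `p`, of the leaf label tensored with the bracket obtained by taking
this leaf as the root, when `c` is attached to the original root. -/
def leafSum (p : FreeQuasiLie α) : FreeQuasiLie α →+ Legs α :=
  (lift isQuasiLieBracket_legBracket
    (fun a => (of a, Finsupp.singleAddHom (M := FreeQuasiLie α) a)) p).2

theorem fst_lift_legBracket (p : FreeQuasiLie α) :
    (lift isQuasiLieBracket_legBracket
      (fun a => (of a, Finsupp.singleAddHom (M := FreeQuasiLie α) a)) p).1 = p := by
  induction p using FreeQuasiLie.induction with
  | of a => rw [lift_of]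
  | zero => rw [map_zero]; rfl
  | add x y hx hy => rw [map_add, Prod.fst_add, hx, hy]
  | neg x hx => rw [map_neg, Prod.fst_neg, hx]
  | mul x y hx hy =>
    rw [lift_mul]
    exact congrArg₂ (· * ·) hx hy

@[simp] theorem leafSum_of (a : α) (c : FreeQuasiLie α) :
    leafSum (of a) c = Finsupp.single a c := by
  rw [leafSum, lift_of]; rfl

theorem leafSum_mul (p q c : FreeQuasiLie α) :
    leafSum (p * q) c = leafSum p (q * c) + leafSum q (c * p) := by
  rw [leafSum, lift_mul]
  change leafSum p (_ * c) + leafSum q (c * _) = _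
  rw [fst_lift_legBracket, fst_lift_legBracket]

@[simp] theorem leafSum_add (p q c : FreeQuasiLie α) :
    leafSum (p + q) c = leafSum p c + leafSum q c := by
  rw [leafSum, map_add]; rfl

@[simp] theorem leafSum_neg (p c : FreeQuasiLie α) : leafSum (-p) c = -leafSum p c := by
  rw [leafSum, map_neg]; rfl

@[simp] theorem leafSum_zero (c : FreeQuasiLie α) : leafSum (0 : FreeQuasiLie α) c = 0 := by
  rw [leafSum, map_zero]; rfl

/-- The bracket map `ℤ^α ⊗ L' → L'`. -/
def legBr : Legs α →+ FreeQuasiLie α :=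
  Finsupp.liftAddHom fun a => AddMonoidHom.mulLeft (of a)

@[simp] theorem legBr_single (a : α) (q : FreeQuasiLie α) :
    legBr (Finsupp.single a q) = of a * q := by
  simp [legBr]

/-- By induction on `p`, since Jacobi gives `[p, [q, c]] + [q, [c, p]] = [[p, q], c]`. It is the
source of both `legBr_eta` and the section of `cokerBr`. -/
theorem legBr_leafSum (p c : FreeQuasiLie α) : legBr (leafSum p c) = p * c := by
  induction p using FreeQuasiLie.induction generalizing c with
  | of a => rw [leafSum_of, legBr_single]
  | zero => simp
  | add x y hx hy => rw [leafSum_add, map_add, hx, hy, add_mul]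
  | neg x hx => rw [leafSum_neg, map_neg, hx, neg_mul]
  | mul x y hx hy =>
    rw [leafSum_mul, map_add, hx, hy, ← sub_eq_zero, antisymm x (y * c), antisymm y (c * x),
      ← neg_eq_zero, ← jacobi x y c]
    abel

variable (α) in
/-- The relations of symmetry and invariance for bilinear forms on `L'`. -/
inductive FormRel : FreeQuasiLie α ⊗[ℤ] FreeQuasiLie α → Prop
  | symm (p q : FreeQuasiLie α) : FormRel (p ⊗ₜ q - q ⊗ₜ p)
  | inv (p q r : FreeQuasiLie α) : FormRel ((p * q) ⊗ₜ r - p ⊗ₜ (q * r))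

variable (α) in
/-- The target of the universal symmetric invariant form on `L'`. -/
abbrev FormGroup : Type :=
  (FreeQuasiLie α ⊗[ℤ] FreeQuasiLie α) ⧸ AddSubgroup.closure {x | FormRel α x}

/-- The universal symmetric invariant form. -/
def form (p : FreeQuasiLie α) : FreeQuasiLie α →+ FormGroup α :=
  (QuotientAddGroup.mk' _).comp (TensorProduct.mk ℤ _ _ p).toAddMonoidHom

theorem form_apply (p q : FreeQuasiLie α) :
    form p q = QuotientAddGroup.mk' (AddSubgroup.closure {x | FormRel α x}) (p ⊗ₜ q) := rfl

theorem form_symm (p q : FreeQuasiLie α) : form p q = form q p := by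
  rw [← sub_eq_zero, form_apply, form_apply, ← map_sub]
  exact (QuotientAddGroup.eq_zero_iff _).2 (AddSubgroup.subset_closure (.symm p q))

theorem form_mul (p q r : FreeQuasiLie α) : form (p * q) r = form p (q * r) := by
  rw [← sub_eq_zero, form_apply, form_apply, ← map_sub]
  exact (QuotientAddGroup.eq_zero_iff _).2 (AddSubgroup.subset_closure (.inv p q r))

@[simp] theorem form_add_left (p q r : FreeQuasiLie α) :
    form (p + q) r = form p r + form q r := by
  rw [form_symm, map_add, form_symm r, form_symm r]

@[simp] theorem form_neg_left (p r : FreeQuasiLie α) : form (-p) r = -form p r := by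
  rw [form_symm, map_neg, form_symm r]

@[simp] theorem form_zero_left (r : FreeQuasiLie α) : form 0 r = 0 := by
  rw [form_symm, map_zero]

theorem form_induction {P : FormGroup α → Prop} (t : FormGroup α) (form : ∀ p q, P (form p q))
    (zero : P 0) (add : ∀ s t, P s → P t → P (s + t)) : P t := by
  obtain ⟨x, rfl⟩ := QuotientAddGroup.mk'_surjective _ t
  induction x using TensorProduct.induction_on with
  | zero => rw [map_zero]; exact zero
  | tmul p q => exact form p q
  | add x y hx hy => rw [map_add]; exact add _ _ hx hy

theorem formHom_ext {G : Type*} [AddCommGroup G] {f g : FormGroup α →+ G}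
    (h : ∀ p q, f (form p q) = g (form p q)) : f = g := by
  refine DFunLike.ext _ _ fun t => ?_
  induction t using form_induction with
  | form p q => exact h p q
  | zero => rw [map_zero, map_zero]
  | add s t hs ht => rw [map_add, map_add, hs, ht]

/-- Symmetric invariant forms factor through the universal one. -/
def formLift {G : Type*} [AddCommGroup G] (B : FreeQuasiLie α → FreeQuasiLie α → G)
    (hadd : ∀ p q r, B p (q + r) = B p q + B p r) (hsymm : ∀ p q, B p q = B q p)
    (hinv : ∀ p q r, B (p * q) r = B p (q * r)) : FormGroup α →+ G :=
  QuotientAddGroup.lift _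
    (TensorProduct.liftAddHom
      (AddMonoidHom.mk' (fun p => AddMonoidHom.mk' (B p) (hadd p)) fun p q => by
        ext r
        change B (p + q) r = B p r + B q r
        rw [hsymm, hadd, hsymm r, hsymm r])
      fun n p q => by rw [map_zsmul, map_zsmul]; rfl) <| by
    rw [AddSubgroup.closure_le]
    rintro _ (⟨p, q⟩ | ⟨p, q, r⟩)
    · exact (map_sub _ _ _).trans (sub_eq_zero.2 (hsymm p q))
    · exact (map_sub _ _ _).trans (sub_eq_zero.2 (hinv p q r))

@[simp] theorem formLift_form {G : Type*} [AddCommGroup G]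
    (B : FreeQuasiLie α → FreeQuasiLie α → G)
    (hadd : ∀ p q r, B p (q + r) = B p q + B p r) (hsymm : ∀ p q, B p q = B q p)
    (hinv : ∀ p q r, B (p * q) r = B p (q * r)) (p q : FreeQuasiLie α) :
    formLift B hadd hsymm hinv (form p q) = B p q := rfl

/-- The map `η` on the universal form: the sum over all choices of root. -/
def eta : FormGroup α →+ Legs α :=
  formLift (fun p q => leafSum p q + leafSum q p)
    (fun p q r => by simp only [map_add, leafSum_add]; abel)
    (fun p q => add_comm _ _)
    (fun p q r => by simp only [leafSum_mul]; abel)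

@[simp] theorem eta_form (p q : FreeQuasiLie α) :
    eta (form p q) = leafSum p q + leafSum q p := rfl

theorem legBr_eta (t : FormGroup α) : legBr (eta t) = 0 := by
  induction t using form_induction with
  | form p q => rw [eta_form, map_add, legBr_leafSum, legBr_leafSum, antisymm, neg_add_cancel]
  | zero => rw [map_zero, map_zero]
  | add s t hs ht => rw [map_add, map_add, hs, ht, add_zero]

/-! ### Exactness at `ℤ^α ⊗ L'` -/

variable (α) in
/-- The cokernel of `η`. -/
abbrev EtaCoker : Type := Legs α ⧸ (eta (α := α)).range

/-- The map from generators and the cokernel of `η` to the free quasi-Lie algebra. -/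
def cokerBr : (α →₀ ℤ) × EtaCoker α →+ FreeQuasiLie α :=
  AddMonoidHom.coprod (Finsupp.liftAddHom fun a => zmultiplesHom _ (of a))
    (QuotientAddGroup.lift _ legBr (by rintro _ ⟨t, rfl⟩; exact legBr_eta t))

/-- A quasi-Lie bracket on generators plus the cokernel of `η`. -/
def cokerBracket (x y : (α →₀ ℤ) × EtaCoker α) : (α →₀ ℤ) × EtaCoker α :=
  (0, QuotientAddGroup.mk' (eta (α := α)).range (leafSum (cokerBr x) (cokerBr y)))

theorem cokerBr_cokerBracket (x y : (α →₀ ℤ) × EtaCoker α) :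
    cokerBr (cokerBracket x y) = cokerBr x * cokerBr y := by
  rw [← legBr_leafSum, cokerBr, cokerBracket, AddMonoidHom.coprod_apply, map_zero, zero_add]
  rfl

theorem mk_leafSum_add (p q : FreeQuasiLie α) :
    QuotientAddGroup.mk' (eta (α := α)).range (leafSum p q) +
      QuotientAddGroup.mk' (eta (α := α)).range (leafSum q p) = 0 := by
  rw [← map_add, ← eta_form]
  exact (QuotientAddGroup.eq_zero_iff _).2 ⟨_, rfl⟩

/-- Antisymmetry is the vanishing of `eta (form p q)` in the cokernel. Up to sign and antisymmetry,
Jacobi is the same relation for `form (p * q) r` expanded by `leafSum_mul`. -/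
theorem isQuasiLieBracket_cokerBracket : IsQuasiLieBracket (cokerBracket (α := α)) where
  add_left x y z := by
    refine Prod.ext (add_zero _).symm ?_
    simp only [cokerBracket, map_add, leafSum_add, Prod.snd_add]
  antisymm x y := by
    refine Prod.ext neg_zero.symm ?_
    exact eq_neg_of_add_eq_zero_left (mk_leafSum_add _ _)
  jacobi x y z := by
    refine Prod.ext (by simp [cokerBracket]) ?_
    change QuotientAddGroup.mk' _ (leafSum (cokerBr (cokerBracket x y)) _) +
      QuotientAddGroup.mk' _ (leafSum (cokerBr (cokerBracket y z)) _) +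
      QuotientAddGroup.mk' _ (leafSum (cokerBr (cokerBracket z x)) _) = 0
    simp only [cokerBr_cokerBracket]
    have h (a b c : FreeQuasiLie α) : QuotientAddGroup.mk' (eta (α := α)).range (leafSum (a * b) c)
        = -QuotientAddGroup.mk' (eta (α := α)).range (leafSum c (a * b)) :=
      eq_neg_of_add_eq_zero_left (mk_leafSum_add _ _)
    rw [h, h, h]
    have e := mk_leafSum_add (cokerBr x * cokerBr y) (cokerBr z)
    rw [leafSum_mul, map_add] at e
    rw [← neg_eq_zero, ← e]
    abel

/-- The section of `cokerBr`. -/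
def cokerSection : FreeQuasiLie α →+ (α →₀ ℤ) × EtaCoker α :=
  lift isQuasiLieBracket_cokerBracket fun a => (Finsupp.single a 1, 0)

theorem cokerBr_cokerSection (q : FreeQuasiLie α) : cokerBr (cokerSection q) = q := by
  induction q using FreeQuasiLie.induction with
  | of a => simp [cokerSection, cokerBr]
  | zero => simp
  | add x y hx hy => rw [map_add, map_add, hx, hy]
  | neg x hx => rw [map_neg, map_neg, hx]
  | mul x y hx hy => rw [cokerSection, lift_mul, cokerBr_cokerBracket]; exact congrArg₂ _ hx hy

/-- On `a ⊗ q` the section returns the class of `leafSum (of a) q`, which is `a ⊗ q` itself. So the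
class of `z` can be recovered from `legBr z`. -/
theorem cokerSection_legBr (z : Legs α) :
    cokerSection (legBr z) = (0, QuotientAddGroup.mk' (eta (α := α)).range z) := by
  induction z using Finsupp.induction_linear with
  | zero => rw [map_zero, map_zero, map_zero]; rfl
  | add f g hf hg => rw [map_add, map_add, hf, hg, map_add, Prod.mk_add_mk, add_zero]
  | single a q =>
    rw [legBr_single, cokerSection, lift_mul]
    change cokerBracket (cokerSection _) (cokerSection _) = _
    rw [cokerBracket, cokerBr_cokerSection, cokerBr_cokerSection, leafSum_of]

theorem exists_eta_eq {z : Legs α} (hz : legBr z = 0) : ∃ t, eta t = z := by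
  have h := cokerSection_legBr z
  rw [hz, map_zero, Prod.ext_iff] at h
  exact (QuotientAddGroup.eq_zero_iff _).1 h.2.symm

end FreeQuasiLie

/-! ### Gradings -/

namespace FreeQuasiLie

variable {α : Type}

/-- The convolution product on finitely supported sequences in `L'`. -/
def conv : (ℕ →₀ FreeQuasiLie α) →+ (ℕ →₀ FreeQuasiLie α) →+ (ℕ →₀ FreeQuasiLie α) :=
  Finsupp.liftAddHom fun i => (Finsupp.liftAddHom fun j =>
    (AddMonoidHom.compHom (Finsupp.singleAddHom (i + j))).comp
      (AddMonoidHom.mul (R := FreeQuasiLie α)).flip).flip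

@[simp] theorem conv_single (i j : ℕ) (a b : FreeQuasiLie α) :
    conv (Finsupp.single i a) (Finsupp.single j b) = Finsupp.single (i + j) (a * b) := by
  simp [conv]

/-- The convolution is `L'` with scalars extended to polynomials; by multilinearity the identities
need checking only on monomials. -/
theorem isQuasiLieBracket_conv : IsQuasiLieBracket fun x y : ℕ →₀ FreeQuasiLie α => conv x y where
  add_left x y z := by rw [map_add]; rfl
  antisymm x y := by
    induction x using Finsupp.induction_linear with
    | zero => simp
    | add f g hf hg => simp only [map_add, AddMonoidHom.add_apply, hf, hg]; abel
    | single i a =>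
      induction y using Finsupp.induction_linear with
      | zero => simp
      | add f g hf hg => simp only [map_add, AddMonoidHom.add_apply, hf, hg]; abel
      | single j b =>
        rw [conv_single, conv_single, ← Finsupp.single_neg, ← FreeQuasiLie.antisymm, add_comm]
  jacobi x y z := by
    have split {a b c d e f : ℕ →₀ FreeQuasiLie α} (h1 : a + b + c = 0) (h2 : d + e + f = 0) :
        a + d + (b + e) + (c + f) = 0 := by
      rw [← add_zero (0 : ℕ →₀ FreeQuasiLie α)]
      nth_rw 1 [← h1]
      rw [← h2]
      abel
    induction x using Finsupp.induction_linear with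
    | zero => simp
    | add f g hf hg => simp only [map_add, AddMonoidHom.add_apply]; exact split hf hg
    | single i a =>
      induction y using Finsupp.induction_linear with
      | zero => simp
      | add f g hf hg => simp only [map_add, AddMonoidHom.add_apply]; exact split hf hg
      | single j b =>
        induction z using Finsupp.induction_linear with
        | zero => simp
        | add f g hf hg => simp only [map_add, AddMonoidHom.add_apply]; exact split hf hg
        | single k c =>
          simp only [conv_single]
          rw [show j + k + i = i + j + k by omega, show k + i + j = i + j + k by omega,
            ← Finsupp.single_add, ← Finsupp.single_add, FreeQuasiLie.jacobi, Finsupp.single_zero]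

/-- The decomposition of elements of `L'` into homogeneous components. -/
def components : FreeQuasiLie α →+ (ℕ →₀ FreeQuasiLie α) :=
  lift isQuasiLieBracket_conv fun a => Finsupp.single 1 (of a)

theorem components_br (I : FreeMagma α) :
    components (br I) = Finsupp.single I.length (br I) := by
  induction I with
  | ih1 a => exact lift_of _ _ _
  | ih2 I J hI hJ =>
    rw [map_mul, components, lift_mul]
    change conv (components _) (components _) = _
    rw [hI, hJ, conv_single]
    rfl

/-- The projection of `L'` to the degrees satisfying `P`. -/
def proj (P : ℕ → Prop) [DecidablePred P] : FreeQuasiLie α →+ FreeQuasiLie α :=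
  (Finsupp.liftAddHom fun k => if P k then AddMonoidHom.id _ else 0).comp components

theorem proj_br (P : ℕ → Prop) [DecidablePred P] (I : FreeMagma α) :
    proj P (br I) = if P I.length then br I else 0 := by
  rw [proj, AddMonoidHom.comp_apply, components_br, Finsupp.liftAddHom_apply_single]
  split_ifs <;> rfl

/-- The projection of `ℤ^α ⊗ L'` to the degrees of the second factor satisfying `P`. -/
def legProj (P : ℕ → Prop) [DecidablePred P] : Legs α →+ Legs α :=
  Finsupp.mapRange.addMonoidHom (proj P)

@[simp] theorem legProj_single (P : ℕ → Prop) [DecidablePred P] (a : α) (q : FreeQuasiLie α) :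
    legProj P (Finsupp.single a q) = Finsupp.single a (proj P q) := by
  simp [legProj]

/-- A tree with `k + 1` leaves loses one leaf to the root, so every term has a second factor of
degree `k`. -/
theorem legProj_leafSum (P : ℕ → Prop) [DecidablePred P] (I C : FreeMagma α) {k : ℕ}
    (hk : I.length + C.length = k + 1) :
    legProj P (leafSum (br I) (br C)) = if P k then leafSum (br I) (br C) else 0 := by
  induction I generalizing C with
  | ih1 a =>
    obtain rfl : C.length = k := by
      have : 1 + C.length = k + 1 := hk
      omega
    rw [br_of, leafSum_of, legProj_single, proj_br]
    split_ifs
    · rfl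
    · exact Finsupp.single_zero _
  | ih2 I J hI hJ =>
    have hk' : I.length + J.length + C.length = k + 1 := hk
    rw [map_mul, leafSum_mul, map_add, ← map_mul, ← map_mul,
      hI (J * C) (show I.length + (J.length + C.length) = k + 1 by omega),
      hJ (C * I) (show J.length + (C.length + I.length) = k + 1 by omega)]
    split_ifs
    · rfl
    · exact add_zero _

/-! ### Forms defined on bracketings -/

/-- Functions on pairs of bracketings respecting the identification of rebased trees and the
relations AS and IHX. -/
structure IsTreeForm {G : Type*} [AddCommGroup G] (f : FreeMagma α → FreeMagma α → G) : Prop where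
  symm : ∀ I J, f I J = f J I
  inv : ∀ I J K, f (I * J) K = f I (J * K)
  as : ∀ I J K, f (I * J) K + f (J * I) K = 0
  ihx : ∀ A B C D, f (A * (B * C)) D - f (A * B * C) D + f (A * C * B) D = 0

section treeForm

variable {G : Type*} [AddCommGroup G] {f : FreeMagma α → FreeMagma α → G}

/-- The biadditive extension of a function on pairs of bracketings. -/
def bilin (f : FreeMagma α → FreeMagma α → G) :
    (FreeMagma α →₀ ℤ) →+ (FreeMagma α →₀ ℤ) →+ G :=
  Finsupp.liftAddHom fun I => zmultiplesHom _ (Finsupp.liftAddHom fun J => zmultiplesHom _ (f I J))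

theorem bilin_single (f : FreeMagma α → FreeMagma α → G) (I J : FreeMagma α) (i j : ℤ) :
    bilin f (Finsupp.single I i) (Finsupp.single J j) = i • j • f I J := by
  simp [bilin]

/-- The biadditive extension to the free non-associative algebra. -/
def algForm (f : FreeMagma α → FreeMagma α → G) (a b : FreeNonUnitalNonAssocAlgebra ℤ α) : G :=
  bilin f a.coeff b.coeff

theorem algForm_single (f : FreeMagma α → FreeMagma α → G) (I J : FreeMagma α) (i j : ℤ) :
    algForm f (.single I i) (.single J j) = i • j • f I J := bilin_single _ _ _ _ _

theorem algForm_add_left (f : FreeMagma α → FreeMagma α → G)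
    (a b c : FreeNonUnitalNonAssocAlgebra ℤ α) :
    algForm f (a + b) c = algForm f a c + algForm f b c := by
  simp [algForm]

theorem algForm_add_right (f : FreeMagma α → FreeMagma α → G)
    (a b c : FreeNonUnitalNonAssocAlgebra ℤ α) :
    algForm f a (b + c) = algForm f a b + algForm f a c := by
  simp [algForm]

theorem algForm_zero_left (f : FreeMagma α → FreeMagma α → G)
    (a : FreeNonUnitalNonAssocAlgebra ℤ α) : algForm f 0 a = 0 := by
  simp [algForm]

theorem algForm_zero_right (f : FreeMagma α → FreeMagma α → G)
    (a : FreeNonUnitalNonAssocAlgebra ℤ α) : algForm f a 0 = 0 := by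
  simp [algForm]

theorem algForm_symm (h : IsTreeForm f) (a b : FreeNonUnitalNonAssocAlgebra ℤ α) :
    algForm f a b = algForm f b a := by
  induction a using MonoidAlgebra.induction_linear with
  | zero => rw [algForm_zero_left, algForm_zero_right]
  | add a a' h1 h2 => rw [algForm_add_left, algForm_add_right, h1, h2]
  | single I i =>
    induction b using MonoidAlgebra.induction_linear with
    | zero => rw [algForm_zero_left, algForm_zero_right]
    | add a a' h1 h2 => rw [algForm_add_left, algForm_add_right, h1, h2]
    | single J j => rw [algForm_single, algForm_single, h.symm, smul_comm]

theorem algForm_mul (h : IsTreeForm f) (a b c : FreeNonUnitalNonAssocAlgebra ℤ α) :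
    algForm f (a * b) c = algForm f a (b * c) := by
  induction a using MonoidAlgebra.induction_linear with
  | zero => rw [zero_mul, algForm_zero_left, algForm_zero_left]
  | add a a' h1 h2 => rw [add_mul, algForm_add_left, algForm_add_left, h1, h2]
  | single I i =>
    induction b using MonoidAlgebra.induction_linear with
    | zero => rw [mul_zero, zero_mul, algForm_zero_left, algForm_zero_right]
    | add a a' h1 h2 => rw [mul_add, add_mul, algForm_add_left, algForm_add_right, h1, h2]
    | single J j =>
      induction c using MonoidAlgebra.induction_linear with
      | zero => rw [mul_zero, algForm_zero_right, algForm_zero_right]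
      | add a a' h1 h2 => rw [mul_add, algForm_add_right, algForm_add_right, h1, h2]
      | single K k =>
        rw [MonoidAlgebra.single_mul_single, MonoidAlgebra.single_mul_single, algForm_single,
          algForm_single, h.inv, mul_smul, mul_smul]

theorem algForm_as (h : IsTreeForm f) (a b c : FreeNonUnitalNonAssocAlgebra ℤ α) :
    algForm f (a * b) c + algForm f (b * a) c = 0 := by
  induction a using MonoidAlgebra.induction_linear with
  | zero => simp [algForm_zero_left]
  | add a a' h1 h2 =>
    rw [add_mul, mul_add, algForm_add_left, algForm_add_left, add_add_add_comm, h1, h2, add_zero]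
  | single I i =>
    induction b using MonoidAlgebra.induction_linear with
    | zero => simp [algForm_zero_left]
    | add a a' h1 h2 =>
      rw [add_mul, mul_add, algForm_add_left, algForm_add_left, add_add_add_comm, h1, h2, add_zero]
    | single J j =>
      induction c using MonoidAlgebra.induction_linear with
      | zero => simp [algForm_zero_right]
      | add a a' h1 h2 =>
        rw [algForm_add_right, algForm_add_right, add_add_add_comm, h1, h2, add_zero]
      | single K k =>
        rw [MonoidAlgebra.single_mul_single, MonoidAlgebra.single_mul_single, algForm_single,
          algForm_single, mul_comm j i, ← smul_add, ← smul_add, h.as, smul_zero, smul_zero]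

/-- By multilinearity this is a statement about four bracketings, where it is IHX up to AS. -/
theorem algForm_jacobi (h : IsTreeForm f) (a b c d : FreeNonUnitalNonAssocAlgebra ℤ α) :
    algForm f (a * b * c) d + algForm f (b * c * a) d + algForm f (c * a * b) d = 0 := by
  have split {a b c d e f : G} (h1 : a + b + c = 0) (h2 : d + e + f = 0) :
      a + d + (b + e) + (c + f) = 0 := by
    rw [← add_zero (0 : G)]
    nth_rw 1 [← h1]
    rw [← h2]
    abel
  induction a using MonoidAlgebra.induction_linear with
  | zero => simp [algForm_zero_left]
  | add a a' h1 h2 => simp only [add_mul, mul_add, algForm_add_left]; exact split h1 h2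
  | single I i =>
    induction b using MonoidAlgebra.induction_linear with
    | zero => simp [algForm_zero_left]
    | add a a' h1 h2 => simp only [add_mul, mul_add, algForm_add_left]; exact split h1 h2
    | single J j =>
      induction c using MonoidAlgebra.induction_linear with
      | zero => simp [algForm_zero_left]
      | add a a' h1 h2 => simp only [add_mul, mul_add, algForm_add_left]; exact split h1 h2
      | single K k =>
        induction d using MonoidAlgebra.induction_linear with
        | zero => simp [algForm_zero_right]
        | add a a' h1 h2 => simp only [algForm_add_right]; exact split h1 h2
        | single L l =>
          -- AS is available only next to the preferred edge, so the edge is first moved by `h.inv`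
          -- to reach the vertex of `K * I`.
          have e : f (I * J * K) L + f (J * K * I) L + f (K * I * J) L = 0 := by
            rw [eq_neg_of_add_eq_zero_left (h.as (J * K) I L), h.inv (K * I),
              eq_neg_of_add_eq_zero_left (h.as K I (J * L)), ← h.inv (I * K), ← neg_eq_zero,
              ← h.ihx I J K L]
            abel
          simp only [MonoidAlgebra.single_mul_single, algForm_single]
          rw [show j * k * i = i * j * k by ring, show k * i * j = i * j * k by ring,
            ← smul_add, ← smul_add, ← smul_add, ← smul_add, e, smul_zero, smul_zero]

/-- The congruence on the free non-associative algebra defined by the radical of a form. -/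
def radical (h : IsTreeForm f) : RingCon (FreeNonUnitalNonAssocAlgebra ℤ α) where
  r a b := ∀ c, algForm f a c = algForm f b c
  iseqv := ⟨fun _ _ => rfl, fun h c => (h c).symm, fun h h' c => (h c).trans (h' c)⟩
  add' h1 h2 c := by rw [algForm_add_left, algForm_add_left, h1, h2]
  -- Invariance isolates the first factor so that it can be exchanged; symmetry and invariance then
  -- rotate the second factor to the front.
  mul' {w x y z} h1 h2 c := by
    rw [algForm_mul h, h1, algForm_symm h, algForm_mul h, h2, ← algForm_mul h, algForm_symm h,
      ← algForm_mul h]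

/-- The radical is a ring congruence containing the quasi-Lie relations, hence it contains the
congruence they generate. This lets the form descend to `L'`. -/
theorem algForm_congr (h : IsTreeForm f) {a b : FreeNonUnitalNonAssocAlgebra ℤ α}
    (hab : mk a = mk b) (c : FreeNonUnitalNonAssocAlgebra ℤ α) :
    algForm f a c = algForm f b c := by
  have hle : ringConGen (FreeQuasiLieRel α) ≤ radical h := by
    rw [RingCon.ringConGen_le]
    rintro _ _ (⟨a, b⟩ | ⟨a, b, c⟩) d
    · have e := algForm_as h a b d
      rw [← algForm_add_left] at e
      have e2 := algForm_add_left f (-(b * a)) (b * a) d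
      rw [neg_add_cancel, algForm_zero_left, ← e, algForm_add_left] at e2
      exact add_right_cancel e2
    · rw [algForm_add_left, algForm_add_left, algForm_zero_left]
      exact algForm_jacobi h a b c d
  exact hle ((RingCon.eq _).1 hab) c

/-- The homomorphism from the universal form group given by a function on pairs of bracketings. -/
def treeFormLift (h : IsTreeForm f) : FormGroup α →+ G :=
  formLift
    -- Arbitrary representatives suffice: by `algForm_congr` and symmetry the value does not depend
    -- on them.
    (fun p q => algForm f (Function.surjInv mk_surjective p) (Function.surjInv mk_surjective q))
    (fun p q r => by
      rw [← algForm_add_right, algForm_symm h, algForm_symm h _ (_ + _)]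
      exact algForm_congr h (by simp only [map_add, Function.surjInv_eq mk_surjective]) _)
    (fun p q => algForm_symm h _ _)
    (fun p q r => by
      rw [algForm_congr h (b := Function.surjInv mk_surjective p * Function.surjInv mk_surjective q)
        (by simp only [map_mul, Function.surjInv_eq mk_surjective]),
        algForm_mul h, algForm_symm h, algForm_symm h _ (Function.surjInv _ (q * r))]
      exact algForm_congr h (by simp only [map_mul, Function.surjInv_eq mk_surjective]) _)

theorem treeFormLift_br (h : IsTreeForm f) (I J : FreeMagma α) :
    treeFormLift h (form (br I) (br J)) = f I J := by
  have hm (K : FreeMagma α) : mk (.single K 1) = br K := by rw [mk_single, one_smul]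
  rw [treeFormLift, formLift_form,
    algForm_congr h (b := .single I 1) (by rw [Function.surjInv_eq mk_surjective, hm]),
    algForm_symm h,
    algForm_congr h (b := .single J 1) (by rw [Function.surjInv_eq mk_surjective, hm]),
    algForm_single, one_smul, one_smul, h.symm]

end treeForm

theorem isTreeForm_form : IsTreeForm fun I J : FreeMagma α => form (br I) (br J) where
  symm _ _ := form_symm _ _
  inv I J K := by rw [map_mul, map_mul, form_mul]
  as I J K := by rw [map_mul, map_mul, antisymm, form_neg_left, neg_add_cancel]
  ihx A B C D := by
    have h : br A * (br B * br C) - br A * br B * br C + br A * br C * br B = 0 := by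
      rw [antisymm (br A) (br B * br C), antisymm (br A) (br C), neg_mul, ← neg_eq_zero,
        ← jacobi (br A) (br B) (br C)]
      abel
    rw [sub_eq_add_neg, ← form_neg_left, ← form_add_left, ← form_add_left]
    simp only [map_mul]
    rw [← sub_eq_add_neg, h, form_zero_left]

/-- All the relations preserve the total number of leaves, so the form can be cut off by that
number. -/
theorem IsTreeForm.restrict {G : Type*} [AddCommGroup G] {f : FreeMagma α → FreeMagma α → G}
    (h : IsTreeForm f) (P : ℕ → Prop) [DecidablePred P] :
    IsTreeForm fun I J => if P (I.length + J.length) then f I J else 0 where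
  symm I J := by simp only [h.symm I J, add_comm I.length]
  inv I J K := by
    change (if P (I.length + J.length + K.length) then _ else _) =
      if P (I.length + (J.length + K.length)) then _ else _
    rw [h.inv, add_assoc]
  as I J K := by
    change (if P (I.length + J.length + K.length) then _ else _) +
      (if P (J.length + I.length + K.length) then _ else _) = _
    rw [add_comm J.length]
    split_ifs
    · exact h.as I J K
    · exact add_zero _
  ihx A B C D := by
    change (if P (A.length + (B.length + C.length) + D.length) then _ else _) -
      (if P (A.length + B.length + C.length + D.length) then _ else _) +
      (if P (A.length + C.length + B.length + D.length) then _ else _) = _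
    rw [← add_assoc A.length, add_right_comm A.length C.length]
    split_ifs
    · exact h.ihx A B C D
    · simp

/-- The projection of the form group to the trees whose number of leaves satisfies `P`. -/
def formProj (P : ℕ → Prop) [DecidablePred P] : FormGroup α →+ FormGroup α :=
  treeFormLift (isTreeForm_form.restrict P)

theorem formProj_br (P : ℕ → Prop) [DecidablePred P] (I J : FreeMagma α) :
    formProj P (form (br I) (br J)) =
      if P (I.length + J.length) then form (br I) (br J) else 0 := treeFormLift_br _ _ _

theorem form_br_ext {G : Type*} [AddCommGroup G] {f g : FormGroup α →+ G}
    (h : ∀ I J, f (form (br I) (br J)) = g (form (br I) (br J))) : f = g := by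
  refine formHom_ext fun p q => ?_
  have h1 (I : FreeMagma α) : f.comp (form (br I)) = g.comp (form (br I)) := addHom_ext (h I)
  have h2 : f.comp (form q) = g.comp (form q) := addHom_ext fun I => by
    have := DFunLike.congr_fun (h1 I) q
    rwa [AddMonoidHom.comp_apply, AddMonoidHom.comp_apply, form_symm] at this
  rw [form_symm]
  exact DFunLike.congr_fun h2 p

/-- The shift by one accounts for the leaf used as the root. -/
theorem eta_formProj (P : ℕ → Prop) [DecidablePred P] (t : FormGroup α) :
    eta (formProj P t) = legProj (fun k => P (k + 1)) (eta t) := by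
  suffices h : eta.comp (formProj P) = (legProj fun k => P (k + 1)).comp (eta (α := α)) from
    DFunLike.congr_fun h t
  refine form_br_ext fun I J => ?_
  have h1 := I.length_pos
  rw [AddMonoidHom.comp_apply, AddMonoidHom.comp_apply, formProj_br, eta_form, map_add,
    legProj_leafSum _ I J (k := I.length + J.length - 1) (by omega),
    legProj_leafSum _ J I (k := I.length + J.length - 1) (by omega),
    Nat.sub_add_cancel (by omega)]
  split_ifs
  · rfl
  · rw [map_zero, add_zero]

end FreeQuasiLie

/-! ### Derivations and functoriality -/

namespace FreeQuasiLie

section derivation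

variable {α : Type}

/-- The bracket on the dual numbers over `L'`. -/
def dualBracket (a b : FreeQuasiLie α × FreeQuasiLie α) : FreeQuasiLie α × FreeQuasiLie α :=
  (a.1 * b.1, a.2 * b.1 + a.1 * b.2)

theorem isQuasiLieBracket_dualBracket : IsQuasiLieBracket (dualBracket (α := α)) where
  add_left a b c := by
    refine Prod.ext (add_mul _ _ _) ?_
    simp only [dualBracket, Prod.fst_add, Prod.snd_add, add_mul]
    abel
  antisymm a b := by
    refine Prod.ext (FreeQuasiLie.antisymm _ _) ?_
    simp only [dualBracket, Prod.snd_neg]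
    rw [FreeQuasiLie.antisymm a.2, FreeQuasiLie.antisymm a.1]
    abel
  jacobi a b c := by
    refine Prod.ext (FreeQuasiLie.jacobi _ _ _) ?_
    simp only [dualBracket, Prod.snd_add, Prod.snd_zero, add_mul]
    have e := congrArg₂ (· + ·) (congrArg₂ (· + ·) (FreeQuasiLie.jacobi a.2 b.1 c.1)
      (FreeQuasiLie.jacobi a.1 b.2 c.1)) (FreeQuasiLie.jacobi a.1 b.1 c.2)
    simp only [add_zero] at e
    rw [← e]
    abel

/-- The derivation of `L'` extending a map of generators. -/
def der (f : α → FreeQuasiLie α) : FreeQuasiLie α →+ FreeQuasiLie α :=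
  (AddMonoidHom.snd _ _).comp (lift isQuasiLieBracket_dualBracket fun a => (of a, f a))

theorem fst_lift_dualBracket (f : α → FreeQuasiLie α) (p : FreeQuasiLie α) :
    (lift isQuasiLieBracket_dualBracket (fun a => (of a, f a)) p).1 = p := by
  induction p using FreeQuasiLie.induction with
  | of a => rw [lift_of]
  | zero => rw [map_zero]; rfl
  | add x y hx hy => rw [map_add, Prod.fst_add, hx, hy]
  | neg x hx => rw [map_neg, Prod.fst_neg, hx]
  | mul x y hx hy =>
    rw [lift_mul]
    exact congrArg₂ (· * ·) hx hy

@[simp] theorem der_of (f : α → FreeQuasiLie α) (a : α) : der f (of a) = f a := by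
  simp [der]

theorem der_mul (f : α → FreeQuasiLie α) (p q : FreeQuasiLie α) :
    der f (p * q) = der f p * q + p * der f q := by
  rw [der, AddMonoidHom.comp_apply, lift_mul]
  change der f p * (Prod.fst _) + (Prod.fst _) * der f q = _
  rw [fst_lift_dualBracket, fst_lift_dualBracket]
  rfl

/-- The action of a derivation on the universal form group. -/
def formDer (f : α → FreeQuasiLie α) : FormGroup α →+ FormGroup α :=
  formLift (fun p q => form (der f p) q + form p (der f q))
    (fun p q r => by simp only [map_add]; abel)
    (fun p q => by rw [form_symm, form_symm p, add_comm])
    (fun p q r => by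
      simp only [der_mul, form_add_left, form_mul, map_add]
      abel)

@[simp] theorem formDer_form (f : α → FreeQuasiLie α) (p q : FreeQuasiLie α) :
    formDer f (form p q) = form (der f p) q + form p (der f q) := rfl

/-- The action of the derivation induced by a map `σ` of the alphabet on `ℤ^α ⊗ L'`. -/
def legDer (σ : α → α) : Legs α →+ Legs α :=
  Finsupp.liftAddHom fun a =>
    Finsupp.singleAddHom (σ a) + (Finsupp.singleAddHom a).comp (der fun a => of (σ a))

@[simp] theorem legDer_single (σ : α → α) (a : α) (q : FreeQuasiLie α) :
    legDer σ (Finsupp.single a q) =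
      Finsupp.single (σ a) q + Finsupp.single a (der (fun a => of (σ a)) q) := by
  simp [legDer]

/-- Leibniz rule over leaves: the derivation acts either on the leaf chosen as the root, which gives
the first summand of `legDer`, or on one of the others. -/
theorem legDer_leafSum (σ : α → α) (p q : FreeQuasiLie α) :
    legDer σ (leafSum p q) =
      leafSum (der (fun a => of (σ a)) p) q + leafSum p (der (fun a => of (σ a)) q) := by
  induction p using FreeQuasiLie.induction generalizing q with
  | of a => simp
  | zero => simp
  | add x y hx hy => simp only [leafSum_add, map_add, hx, hy]; abel
  | neg x hx => simp only [leafSum_neg, map_neg, hx]; abel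
  | mul x y hx hy =>
    simp only [leafSum_mul, der_mul, map_add, leafSum_add, hx, hy]
    abel

theorem eta_formDer (σ : α → α) (t : FormGroup α) :
    eta (formDer (fun a => of (σ a)) t) = legDer σ (eta t) := by
  induction t using form_induction with
  | form p q =>
    simp only [formDer_form, map_add, eta_form, legDer_leafSum]
    abel
  | zero => simp
  | add s t hs ht => simp only [map_add, hs, ht]

end derivation

section map

variable {α β : Type}

/-- The map of form groups induced by a homomorphism of free quasi-Lie algebras. -/
def formMap (f : α → FreeQuasiLie β) : FormGroup α →+ FormGroup β :=
  formLift (fun p q => form (hom f p) (hom f q)) (fun p q r => by simp only [map_add])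
    (fun p q => form_symm _ _) (fun p q r => by rw [hom_mul, hom_mul, form_mul])

@[simp] theorem formMap_form (f : α → FreeQuasiLie β) (p q : FreeQuasiLie α) :
    formMap f (form p q) = form (hom f p) (hom f q) := rfl

end map

/-! ### Elimination of a letter -/

section elimination

variable {α : Type} (x : α)

/-- The letters other than `x`. -/
abbrev Others : Type := {y : α // y ≠ x}

/-- The alphabet of the words `[x, [x, ..., [x, y]]]`. -/
abbrev Words : Type := ℕ × Others x

/-- The word `[x, [x, ..., [x, y]]]`. -/
def word (w : Words x) : FreeQuasiLie α := (fun q => of x * q)^[w.1] (of w.2.1)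

theorem word_zero (y : Others x) : word x (0, y) = of y.1 := rfl

theorem word_succ (i : ℕ) (y : Others x) : word x (i + 1, y) = of x * word x (i, y) :=
  Function.iterate_succ_apply' _ _ _

/-- The substitution of words for letters. -/
def subst : FreeQuasiLie (Words x) →+ FreeQuasiLie α := hom (word x)

theorem subst_of (w : Words x) : subst x (of w) = word x w := hom_of _ _

theorem subst_mul (p q : FreeQuasiLie (Words x)) :
    subst x (p * q) = subst x p * subst x q := hom_mul _ _ _

/-- The map of alphabets given by bracketing a word with `x`. -/
def shift (w : Words x) : Words x := (w.1 + 1, w.2)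

/-- The derivation corresponding to bracketing with `x`. -/
def adx : FreeQuasiLie (Words x) →+ FreeQuasiLie (Words x) := der fun w => of (shift x w)

theorem adx_of (w : Words x) : adx x (of w) = of (shift x w) := der_of _ _

theorem adx_mul (p q : FreeQuasiLie (Words x)) : adx x (p * q) = adx x p * q + p * adx x q :=
  der_mul _ _ _

/-- Bracketing with `x` is a derivation by Jacobi, and on words it is the shift. -/
theorem subst_adx (q : FreeQuasiLie (Words x)) : subst x (adx x q) = of x * subst x q := by
  induction q using FreeQuasiLie.induction with
  | of w => rw [adx_of, subst_of, subst_of, shift, word_succ]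
  | zero => simp
  | add p q hp hq => simp only [map_add, hp, hq, mul_add]
  | neg p hp => simp only [map_neg, hp, mul_neg]
  | mul p q hp hq =>
    rw [adx_mul, map_add, subst_mul, subst_mul, subst_mul, hp, hq,
      antisymm (of x) (subst x p * subst x q), antisymm (subst x p) (of x * subst x q),
      antisymm (of x) (subst x q), ← sub_eq_zero, ← jacobi (of x) (subst x p) (subst x q), neg_mul]
    abel

/-- The bracket of the semidirect product of `ℤ x` and the free quasi-Lie algebra on words. -/
def semidirect (a b : ℤ × FreeQuasiLie (Words x)) : ℤ × FreeQuasiLie (Words x) :=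
  (0, a.1 • adx x b.2 - b.1 • adx x a.2 + a.2 * b.2)

theorem isQuasiLieBracket_semidirect : IsQuasiLieBracket (semidirect x) where
  add_left a b c := by
    refine Prod.ext (add_zero _).symm ?_
    simp only [semidirect, Prod.fst_add, Prod.snd_add, add_mul, map_add]
    module
  antisymm a b := by
    refine Prod.ext neg_zero.symm ?_
    simp only [semidirect, Prod.snd_neg, FreeQuasiLie.antisymm a.2]
    abel
  jacobi a b c := by
    refine Prod.ext (by simp [semidirect]) ?_
    simp only [semidirect, Prod.snd_add, Prod.snd_zero, add_mul, sub_mul, map_add, map_sub,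
      adx_mul, map_zsmul, smul_mul_assoc]
    rw [FreeQuasiLie.antisymm a.2 (adx x b.2), FreeQuasiLie.antisymm b.2 (adx x c.2),
      FreeQuasiLie.antisymm c.2 (adx x a.2), ← FreeQuasiLie.jacobi a.2 b.2 c.2]
    module

open Classical in
/-- The retraction of the substitution of words. -/
def retract : FreeQuasiLie α →+ ℤ × FreeQuasiLie (Words x) :=
  lift (isQuasiLieBracket_semidirect x) fun a =>
    if h : a = x then (1, 0) else (0, of (0, ⟨a, h⟩))

/-- In the semidirect product, bracketing with `(1, 0)` applies `adx`, so the word `(i, y)` maps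
back to the generator of that name. This is the freeness part of Lazard elimination. -/
theorem retract_subst (q : FreeQuasiLie (Words x)) : retract x (subst x q) = (0, q) := by
  induction q using FreeQuasiLie.induction with
  | of w =>
    obtain ⟨i, y⟩ := w
    rw [subst_of]
    induction i with
    | zero => rw [word_zero, retract, lift_of, dif_neg y.2]
    | succ i ih =>
      rw [word_succ, retract, lift_mul]
      change semidirect x (retract x _) (retract x _) = _
      rw [ih, retract, lift_of, dif_pos rfl]
      simp [semidirect, adx_of, shift]
  | zero => rw [map_zero, map_zero]; rfl
  | add p q hp hq => simp only [map_add, hp, hq]; simp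
  | neg p hp => simp only [map_neg, hp]; simp
  | mul p q hp hq =>
    rw [subst_mul, retract, lift_mul]
    change semidirect x (retract x _) (retract x _) = _
    rw [hp, hq]
    simp [semidirect]

theorem subst_injective : Function.Injective (subst x) := fun p q h => by
  have := congrArg (retract x) h
  rw [retract_subst, retract_subst] at this
  exact (Prod.ext_iff.1 this).2

/-- The contribution to the root at `x` of the leaves of a word. -/
def wordLegs : ℕ → Others x → (FreeQuasiLie (Words x) →+ Legs (Words x))
  | 0, _ => 0
  | i + 1, y => Finsupp.singleAddHom (i, y) + (wordLegs i y).comp (-adx x)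

/-- The bracket at the last leaf of a word. -/
def wordEnd : ℕ → (FreeQuasiLie (Words x) →+ FreeQuasiLie (Words x))
  | 0 => AddMonoidHom.id _
  | i + 1 => (wordEnd i).comp (-adx x)

/-- Linear extension of `wordLegs`. -/
def expand : Legs (Words x) →+ Legs (Words x) :=
  Finsupp.liftAddHom fun w => wordLegs x w.1 w.2

/-- Linear extension of `wordEnd`. -/
def ends : Legs (Words x) →+ (Others x →₀ FreeQuasiLie (Words x)) :=
  Finsupp.liftAddHom fun w => (Finsupp.singleAddHom w.2).comp (wordEnd x w.1)

/-- The inclusion of the letters other than `x` in the words. -/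
def inclEnds : (Others x →₀ FreeQuasiLie (Words x)) →+ Legs (Words x) :=
  Finsupp.liftAddHom fun y => Finsupp.singleAddHom (0, y)

/-- The substitution of words, on the letters other than `x`. -/
def substEnds : (Others x →₀ FreeQuasiLie (Words x)) →+ Legs α :=
  Finsupp.liftAddHom fun y => (Finsupp.singleAddHom y.1).comp (subst x)

/-- A telescoping sum: differentiating the term at `(i, y)` yields the term at `(i + 1, y)` and an
`adx` term, which cancels against the next term of the expansion. Only the end of the word survives.
-/
theorem legDer_expand (f : Legs (Words x)) :
    legDer (shift x) (expand x f) + inclEnds x (ends x f) = f := by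
  induction f using Finsupp.induction_linear with
  | zero => simp
  | add f g hf hg =>
    simp only [map_add]
    rw [add_add_add_comm, hf, hg]
  | single w q =>
    obtain ⟨i, y⟩ := w
    simp only [expand, ends, inclEnds, Finsupp.liftAddHom_apply_single, AddMonoidHom.comp_apply,
      Finsupp.singleAddHom_apply]
    induction i generalizing q with
    | zero => simp [wordLegs, wordEnd]
    | succ i ih =>
      simp only [wordLegs, wordEnd, AddMonoidHom.add_apply, AddMonoidHom.comp_apply, map_add,
        AddMonoidHom.neg_apply, Finsupp.singleAddHom_apply, legDer_single]
      rw [add_assoc, ih]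
      change Finsupp.single (i + 1, y) q + Finsupp.single (i, y) (adx x q) + _ = _
      rw [Finsupp.single_neg, add_neg_cancel_right]

/-- Rooting at the outermost `x` leaves the bracket of the shorter word with `q`. Rooting further
inside replaces `q` by `[q, x]`, which is the image of `-adx x q`. -/
theorem leafSum_word (i : ℕ) (y : Others x) (q : FreeQuasiLie (Words x)) :
    leafSum (word x (i, y)) (subst x q) =
      Finsupp.single x (subst x (legBr (wordLegs x i y q))) +
        Finsupp.single y.1 (subst x (wordEnd x i q)) := by
  induction i generalizing q with
  | zero => simp [word_zero, wordLegs, wordEnd]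
  | succ i ih =>
    rw [word_succ, leafSum_mul, leafSum_of, antisymm (subst x q) (of x), ← subst_adx, ← map_neg,
      ih, ← add_assoc, ← Finsupp.single_add, ← subst_of, ← subst_mul, ← map_add]
    simp [wordLegs, wordEnd]

/-- The map of sums over leaves induced by the substitution of words. -/
def legSubst : Legs (Words x) →+ Legs α :=
  (Finsupp.singleAddHom x).comp ((subst x).comp (legBr.comp (expand x))) +
    (substEnds x).comp (ends x)

theorem legSubst_apply (f : Legs (Words x)) :
    legSubst x f = Finsupp.single x (subst x (legBr (expand x f))) + substEnds x (ends x f) := rfl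

theorem leafSum_subst (p q : FreeQuasiLie (Words x)) :
    leafSum (subst x p) (subst x q) = legSubst x (leafSum p q) := by
  induction p using FreeQuasiLie.induction generalizing q with
  | of w =>
    rw [subst_of, leafSum_word, leafSum_of, legSubst_apply]
    simp [expand, ends, substEnds]
  | zero => simp
  | add p p' h h' => simp only [map_add, leafSum_add, h, h']
  | neg p h => simp only [map_neg, leafSum_neg, h]
  | mul p p' h h' => simp only [subst_mul, leafSum_mul, map_add, ← h, ← h']

theorem eta_formMap_word (t : FormGroup (Words x)) :
    eta (formMap (word x) t) = legSubst x (eta t) := by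
  induction t using form_induction with
  | form p q =>
    rw [formMap_form, eta_form, eta_form, map_add, ← leafSum_subst, ← leafSum_subst]
    rfl
  | zero => simp
  | add s t hs ht => simp only [map_add, hs, ht]

theorem substEnds_apply_self (g : Others x →₀ FreeQuasiLie (Words x)) : substEnds x g x = 0 := by
  induction g using Finsupp.induction_linear with
  | zero => simp
  | add f g hf hg => rw [map_add, Finsupp.add_apply, hf, hg, add_zero]
  | single y q =>
    simp only [substEnds, Finsupp.liftAddHom_apply_single, AddMonoidHom.comp_apply,
      Finsupp.singleAddHom_apply]
    exact Finsupp.single_eq_of_ne y.2.symm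

theorem substEnds_apply (g : Others x →₀ FreeQuasiLie (Words x)) (y : Others x) :
    substEnds x g y.1 = subst x (g y) := by
  classical
  induction g using Finsupp.induction_linear with
  | zero => simp
  | add f g hf hg => rw [map_add, Finsupp.add_apply, hf, hg, Finsupp.add_apply, map_add]
  | single z q =>
    simp only [substEnds, Finsupp.liftAddHom_apply_single, AddMonoidHom.comp_apply,
      Finsupp.singleAddHom_apply, Finsupp.single_apply, Subtype.ext_iff]
    split_ifs
    · rfl
    · rw [map_zero]

/-- If the image of a sum over leaves under substitution of words vanishes, it comes from
bracketing with `x`. -/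
theorem exists_eta_formDer {t : FormGroup (Words x)} (h : eta (formMap (word x) t) = 0) :
    ∃ s, eta (formDer (fun w => of (shift x w)) s) = eta t := by
  rw [eta_formMap_word, legSubst_apply] at h
  -- The coordinate at `x`, into which `substEnds` does not contribute.
  have h1 : legBr (expand x (eta t)) = 0 := by
    have := DFunLike.congr_fun h x
    rw [Finsupp.add_apply, Finsupp.single_eq_same, substEnds_apply_self, add_zero] at this
    exact subst_injective x (this.trans (map_zero _).symm)
  -- The coordinates at the other letters.
  have h2 : ends x (eta t) = 0 := by
    ext y
    have := DFunLike.congr_fun h y.1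
    rw [Finsupp.add_apply, Finsupp.single_eq_of_ne y.2, substEnds_apply, zero_add] at this
    exact subst_injective x (this.trans (map_zero _).symm)
  obtain ⟨s, hs⟩ := exists_eta_eq h1
  refine ⟨s, ?_⟩
  -- With no ends left, `eta t` is the derivative of its expansion, and the expansion is `eta s` by
  -- exactness.
  have h3 := legDer_expand x (eta t)
  rwa [h2, map_zero, add_zero, ← hs, ← eta_formDer] at h3

/-- Invariance of the form under bracketing with `x`: `⟨[x, p], q⟩ + ⟨p, [x, q]⟩ = 0`. -/
theorem formMap_formDer (s : FormGroup (Words x)) :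
    formMap (word x) (formDer (fun w => of (shift x w)) s) = 0 := by
  induction s using form_induction with
  | form p q =>
    rw [formDer_form, map_add, formMap_form, formMap_form]
    change form (subst x (adx x p)) (subst x q) + form (subst x p) (subst x (adx x q)) = 0
    rw [subst_adx, subst_adx, ← form_mul, antisymm (of x), form_neg_left, neg_add_cancel]
  | zero => simp
  | add s t hs ht => simp only [map_add, hs, ht, add_zero]

end elimination

end FreeQuasiLie

/-! ### Injectivity of `η` -/

namespace FreeQuasiLie

/-- Induction on membership in two additive closures. -/
@[elab_as_elim]
theorem closure_pair_induction {A B : Type*} [AddCommGroup A] [AddCommGroup B] {s : Set A}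
    {t : Set B} {p : ∀ x y, x ∈ AddSubgroup.closure s → y ∈ AddSubgroup.closure t → Prop}
    (mem : ∀ x y (hx : x ∈ s) (hy : y ∈ t),
      p x y (AddSubgroup.subset_closure hx) (AddSubgroup.subset_closure hy))
    (zero_left : ∀ y hy, p 0 y (zero_mem _) hy) (zero_right : ∀ x hx, p x 0 hx (zero_mem _))
    (add_left : ∀ x x' y hx hx' hy, p x y hx hy → p x' y hx' hy → p (x + x') y (add_mem hx hx') hy)
    (add_right : ∀ x y y' hx hy hy', p x y hx hy → p x y' hx hy' → p x (y + y') hx (add_mem hy hy'))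
    (neg_left : ∀ x y hx hy, p x y hx hy → p (-x) y (neg_mem hx) hy)
    (neg_right : ∀ x y hx hy, p x y hx hy → p x (-y) hx (neg_mem hy)) {x : A} {y : B}
    (hx : x ∈ AddSubgroup.closure s) (hy : y ∈ AddSubgroup.closure t) : p x y hx hy := by
  induction hx using AddSubgroup.closure_induction with
  | mem x hx =>
    induction hy using AddSubgroup.closure_induction with
    | mem y hy => exact mem x y hx hy
    | zero => exact zero_right _ _
    | add _ _ _ _ h1 h2 => exact add_right _ _ _ _ _ _ h1 h2
    | neg _ _ h => exact neg_right _ _ _ _ h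
  | zero => exact zero_left _ _
  | add _ _ _ _ h1 h2 => exact add_left _ _ _ _ _ _ h1 h2
  | neg _ _ h => exact neg_left _ _ _ _ h

/-! ### Homogeneous elements and trees with a bounded number of leaves. -/

section degrees

variable {α : Type}

variable (α) in
/-- The span of the brackets of length `k`. -/
def deg (k : ℕ) : AddSubgroup (FreeQuasiLie α) :=
  AddSubgroup.closure {q | ∃ I : FreeMagma α, I.length = k ∧ br I = q}

theorem br_mem_deg (I : FreeMagma α) : br I ∈ deg α I.length :=
  AddSubgroup.subset_closure ⟨I, rfl, rfl⟩

theorem mul_mem_deg {k l : ℕ} {p q : FreeQuasiLie α} (hp : p ∈ deg α k) (hq : q ∈ deg α l) :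
    p * q ∈ deg α (k + l) := by
  induction hp, hq using closure_pair_induction with
  | mem _ _ h1 h2 =>
    obtain ⟨I, rfl, rfl⟩ := h1
    obtain ⟨J, rfl, rfl⟩ := h2
    rw [← map_mul]
    exact br_mem_deg (I * J)
  | zero_left => rw [zero_mul]; exact zero_mem _
  | zero_right => rw [mul_zero]; exact zero_mem _
  | add_left _ _ _ _ _ _ h1 h2 => rw [add_mul]; exact add_mem h1 h2
  | add_right _ _ _ _ _ _ h1 h2 => rw [mul_add]; exact add_mem h1 h2
  | neg_left _ _ _ _ h => rw [neg_mul]; exact neg_mem h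
  | neg_right _ _ _ _ h => rw [mul_neg]; exact neg_mem h

theorem der_mem_deg (σ : α → α) (I : FreeMagma α) :
    der (fun a => of (σ a)) (br I) ∈ deg α I.length := by
  induction I with
  | ih1 a => rw [br_of, der_of]; exact br_mem_deg (FreeMagma.of (σ a))
  | ih2 I J hI hJ =>
    rw [map_mul, der_mul]
    exact add_mem (mul_mem_deg hI (br_mem_deg J)) (mul_mem_deg (br_mem_deg I) hJ)

theorem formProj_form (P : ℕ → Prop) [DecidablePred P] {k l : ℕ} {p q : FreeQuasiLie α}
    (hp : p ∈ deg α k) (hq : q ∈ deg α l) :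
    formProj P (form p q) = if P (k + l) then form p q else 0 := by
  induction hp, hq using closure_pair_induction with
  | mem _ _ h1 h2 =>
    obtain ⟨I, rfl, rfl⟩ := h1
    obtain ⟨J, rfl, rfl⟩ := h2
    exact formProj_br P I J
  | zero_left => simp
  | zero_right => simp
  | add_left _ _ _ _ _ _ h1 h2 => rw [form_add_left, map_add, h1, h2]; split_ifs <;> simp
  | add_right _ _ _ _ _ _ h1 h2 => rw [map_add, map_add, h1, h2]; split_ifs <;> simp
  | neg_left _ _ _ _ h => rw [form_neg_left, map_neg, h]; split_ifs <;> simp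
  | neg_right _ _ _ _ h => rw [map_neg, map_neg, h]; split_ifs <;> simp

/-- Replacing one letter by another keeps the number of leaves. For words this counts words, so
`shift` leaves it unchanged although words get longer in `x`. -/
theorem formProj_formDer (P : ℕ → Prop) [DecidablePred P] (σ : α → α) (s : FormGroup α) :
    formProj P (formDer (fun a => of (σ a)) s) = formDer (fun a => of (σ a)) (formProj P s) := by
  suffices h : (formProj P).comp (formDer fun a => of (σ a)) =
      (formDer fun a => of (σ a)).comp (formProj P) from DFunLike.congr_fun h s
  refine form_br_ext fun I J => ?_
  rw [AddMonoidHom.comp_apply, AddMonoidHom.comp_apply, formDer_form, map_add,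
    formProj_form P (der_mem_deg σ I) (br_mem_deg J),
    formProj_form P (br_mem_deg I) (der_mem_deg σ J), formProj_br]
  split_ifs <;> simp

variable (α) in
/-- The span of the trees with fewer than `n` leaves. -/
def small (n : ℕ) : AddSubgroup (FormGroup α) :=
  AddSubgroup.closure
    {t | ∃ I J : FreeMagma α, I.length + J.length < n ∧ form (br I) (br J) = t}

theorem form_mem_small {n k l : ℕ} (h : k + l < n) {p q : FreeQuasiLie α}
    (hp : p ∈ deg α k) (hq : q ∈ deg α l) : form p q ∈ small α n := by
  induction hp, hq using closure_pair_induction with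
  | mem _ _ h1 h2 =>
    obtain ⟨I, rfl, rfl⟩ := h1
    obtain ⟨J, rfl, rfl⟩ := h2
    exact AddSubgroup.subset_closure ⟨I, J, h, rfl⟩
  | zero_left => rw [form_zero_left]; exact zero_mem _
  | zero_right => rw [map_zero]; exact zero_mem _
  | add_left _ _ _ _ _ _ h1 h2 => rw [form_add_left]; exact add_mem h1 h2
  | add_right _ _ _ _ _ _ h1 h2 => rw [map_add]; exact add_mem h1 h2
  | neg_left _ _ _ _ h => rw [form_neg_left]; exact neg_mem h
  | neg_right _ _ _ _ h => rw [map_neg]; exact neg_mem h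

theorem formProj_mem_small (t : FormGroup α) (n : ℕ) : formProj (· < n) t ∈ small α n := by
  suffices h : (QuotientAddGroup.mk' (small α n)).comp (formProj (· < n)) = 0 from
    (QuotientAddGroup.eq_zero_iff _).1 (DFunLike.congr_fun h t)
  refine form_br_ext fun I J => ?_
  rw [AddMonoidHom.comp_apply, formProj_br, AddMonoidHom.zero_apply]
  split_ifs with h
  · exact (QuotientAddGroup.eq_zero_iff _).2 (AddSubgroup.subset_closure ⟨I, J, h, rfl⟩)
  · exact map_zero _

theorem formProj_eq_self {n : ℕ} {t : FormGroup α} (ht : t ∈ small α n) :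
    formProj (· < n) t = t := by
  induction ht using AddSubgroup.closure_induction with
  | mem _ h => obtain ⟨I, J, h, rfl⟩ := h; rw [formProj_br, if_pos h]
  | zero => exact map_zero _
  | add _ _ _ _ h1 h2 => rw [map_add, h1, h2]
  | neg _ _ h => rw [map_neg, h]

theorem exists_mem_small (t : FormGroup α) : ∃ n, t ∈ small α n := by
  have mono {m n : ℕ} (h : m ≤ n) : small α m ≤ small α n :=
    AddSubgroup.closure_mono fun _ ⟨I, J, h', e⟩ => ⟨I, J, by omega, e⟩
  induction t using form_induction with
  | zero => exact ⟨0, zero_mem _⟩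
  | add s t hs ht =>
    obtain ⟨m, hm⟩ := hs
    obtain ⟨n, hn⟩ := ht
    exact ⟨max m n, add_mem (mono (le_max_left _ _) hm) (mono (le_max_right _ _) hn)⟩
  | form p q =>
    induction p using FreeQuasiLie.induction generalizing q with
    | zero => exact ⟨0, by rw [form_zero_left]; exact zero_mem _⟩
    | add x y hx hy =>
      obtain ⟨m, hm⟩ := hx q
      obtain ⟨n, hn⟩ := hy q
      refine ⟨max m n, ?_⟩
      rw [form_add_left]
      exact add_mem (mono (le_max_left _ _) hm) (mono (le_max_right _ _) hn)
    | neg x hx =>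
      obtain ⟨m, hm⟩ := hx q
      refine ⟨m, ?_⟩
      rw [form_neg_left]
      exact neg_mem hm
    -- Invariance moves factors to the other side until a single letter remains on the left.
    | mul x y hx hy => rw [form_mul]; exact hx _
    | of a =>
      have hq := mem_closure_br q
      induction hq using AddSubgroup.closure_induction with
      | mem _ h =>
        obtain ⟨J, rfl⟩ := h
        exact ⟨1 + J.length + 1, AddSubgroup.subset_closure
          ⟨FreeMagma.of a, J, Nat.lt_succ_self _, rfl⟩⟩
      | zero => exact ⟨0, by rw [map_zero]; exact zero_mem _⟩
      | add x y _ _ hx hy =>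
        obtain ⟨m, hm⟩ := hx
        obtain ⟨n, hn⟩ := hy
        refine ⟨max m n, ?_⟩
        rw [map_add]
        exact add_mem (mono (le_max_left _ _) hm) (mono (le_max_right _ _) hn)
      | neg x _ hx =>
        obtain ⟨m, hm⟩ := hx
        refine ⟨m, ?_⟩
        rw [map_neg]
        exact neg_mem hm

end degrees

/-! ### Splitting off a letter: brackets and trees in terms of words. -/

section split

variable {α : Type} (x : α)

/-- Generators of the subgroup of `L'` spanned by `x`, `[x, x]` and the brackets of at most `k`
words. -/
inductive SplitGen (k : ℕ) : FreeQuasiLie α → Prop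
  | letter : SplitGen k (of x)
  | sq : SplitGen k (of x * of x)
  | subst (I : FreeMagma (Words x)) (h : I.length ≤ k) : SplitGen k (subst x (br I))

/-- The subgroup of `L'` spanned by `x`, `[x, x]` and the brackets of at most `k` words. -/
def splitSpan (k : ℕ) : AddSubgroup (FreeQuasiLie α) := AddSubgroup.closure {q | SplitGen x k q}

theorem subst_mem_splitSpan {k l : ℕ} (h : k ≤ l) {q : FreeQuasiLie (Words x)}
    (hq : q ∈ deg _ k) : subst x q ∈ splitSpan x l := by
  induction hq using AddSubgroup.closure_induction with
  | mem _ hq =>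
    obtain ⟨I, rfl, rfl⟩ := hq
    exact AddSubgroup.subset_closure (.subst I h)
  | zero => rw [map_zero]; exact zero_mem _
  | add _ _ _ _ h1 h2 => rw [map_add]; exact add_mem h1 h2
  | neg _ _ h => rw [map_neg]; exact neg_mem h

theorem letter_mul_subst_mem {k l : ℕ} (I : FreeMagma (Words x)) (hk : I.length ≤ k + l) :
    of x * subst x (br I) ∈ splitSpan x (k + l) := by
  rw [← subst_adx]
  exact subst_mem_splitSpan x hk (der_mem_deg _ I)

/-- Squares are central, and bracketing with `x` only shifts one word at a time, so the word count
never exceeds the sum. -/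
theorem mul_mem_splitSpan {k l : ℕ} {p q : FreeQuasiLie α} (hp : p ∈ splitSpan x k)
    (hq : q ∈ splitSpan x l) : p * q ∈ splitSpan x (k + l) := by
  induction hp, hq using closure_pair_induction with
  | mem _ _ h1 h2 =>
    rcases h1 with _ | _ | ⟨I, hI⟩
    · rcases h2 with _ | _ | ⟨J, hJ⟩
      · exact AddSubgroup.subset_closure .sq
      · rw [mul_sq]; exact zero_mem _
      · exact letter_mul_subst_mem x J (by omega)
    · rw [sq_mul]; exact zero_mem _
    · rcases h2 with _ | _ | ⟨J, hJ⟩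
      · rw [antisymm]; exact neg_mem (letter_mul_subst_mem x I (by omega))
      · rw [mul_sq]; exact zero_mem _
      · rw [← subst_mul, ← map_mul]
        exact AddSubgroup.subset_closure (.subst (I * J) (Nat.add_le_add hI hJ))
  | zero_left => rw [zero_mul]; exact zero_mem _
  | zero_right => rw [mul_zero]; exact zero_mem _
  | add_left _ _ _ _ _ _ h1 h2 => rw [add_mul]; exact add_mem h1 h2
  | add_right _ _ _ _ _ _ h1 h2 => rw [mul_add]; exact add_mem h1 h2
  | neg_left _ _ _ _ h => rw [neg_mul]; exact neg_mem h
  | neg_right _ _ _ _ h => rw [mul_neg]; exact neg_mem h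

/-- Linear combinations of letters. -/
def letters : (α →₀ ℤ) →+ FreeQuasiLie α :=
  Finsupp.liftAddHom fun a => zmultiplesHom _ (of a)

@[simp] theorem letters_single (a : α) (n : ℤ) : letters (Finsupp.single a n) = n • of a := by
  simp [letters]

/-- The span of the images of trees with fewer than `n` words as leaves, and of the trees
`⟨x, a⟩` and `⟨[x, x], a⟩` with `a` a letter. -/
def treeSpan (n : ℕ) : AddSubgroup (FormGroup α) :=
  (small (Words x) n).map (formMap (word x)) ⊔
    (((form (of x)).comp letters).range ⊔ ((form (of x * of x)).comp letters).range)

theorem formMap_mem_treeSpan {n : ℕ} {t : FormGroup (Words x)} (ht : t ∈ small _ n) :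
    formMap (word x) t ∈ treeSpan x n :=
  AddSubgroup.mem_sup_left ⟨t, ht, rfl⟩

theorem form_letter_mem (n : ℕ) (a : α) : form (of x) (of a) ∈ treeSpan x n :=
  AddSubgroup.mem_sup_right (AddSubgroup.mem_sup_left ⟨Finsupp.single a 1, by simp⟩)

theorem form_sq_mem (n : ℕ) (a : α) : form (of x * of x) (of a) ∈ treeSpan x n :=
  AddSubgroup.mem_sup_right (AddSubgroup.mem_sup_right ⟨Finsupp.single a 1, by simp⟩)

/-- Invariance absorbs `x` into a factor of a product of words. Against a single word with at least
two letters `x`, invariance produces `[[x, x], x] = 0`; shorter words give the exceptional trees. -/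
theorem form_letter_subst_mem {n : ℕ} (I : FreeMagma (Words x)) (hI : I.length < n) :
    form (of x) (subst x (br I)) ∈ treeSpan x n := by
  induction I with
  | ih1 w =>
    obtain ⟨i, y⟩ := w
    rw [br_of, subst_of]
    match i with
    | 0 => exact form_letter_mem x n y.1
    | 1 => rw [word_succ, word_zero, ← form_mul]; exact form_sq_mem x n y.1
    | i + 2 =>
      rw [word_succ, word_succ, ← form_mul, ← form_mul, sq_mul, form_zero_left]
      exact zero_mem _
  | ih2 I J _ _ =>
    rw [map_mul, subst_mul, ← form_mul, ← subst_adx]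
    exact formMap_mem_treeSpan x (form_mem_small hI (der_mem_deg _ I) (br_mem_deg J))

/-- By invariance and centrality of `[x, x]`, the pairing vanishes on every bracket, so only bare
letters contribute. -/
theorem form_sq_subst_mem (n : ℕ) (I : FreeMagma (Words x)) :
    form (of x * of x) (subst x (br I)) ∈ treeSpan x n := by
  induction I with
  | ih1 w =>
    obtain ⟨i, y⟩ := w
    rw [br_of, subst_of]
    cases i with
    | zero => exact form_sq_mem x n y.1
    | succ i => rw [word_succ, ← form_mul, sq_mul, form_zero_left]; exact zero_mem _
  | ih2 I J _ _ =>
    rw [map_mul, subst_mul, ← form_mul, sq_mul, form_zero_left]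
    exact zero_mem _

theorem form_mem_treeSpan {k l n : ℕ} (h : k + l < n) {p q : FreeQuasiLie α}
    (hp : p ∈ splitSpan x k) (hq : q ∈ splitSpan x l) : form p q ∈ treeSpan x n := by
  induction hp, hq using closure_pair_induction with
  | mem _ _ h1 h2 =>
    rcases h1 with _ | _ | ⟨I, hI⟩
    · rcases h2 with _ | _ | ⟨J, hJ⟩
      · exact form_letter_mem x n x
      · rw [form_symm]; exact form_sq_mem x n x
      · exact form_letter_subst_mem x J (by omega)
    · rcases h2 with _ | _ | ⟨J, hJ⟩
      · exact form_sq_mem x n x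
      · rw [← form_mul, sq_mul, form_zero_left]; exact zero_mem _
      · exact form_sq_subst_mem x n J
    · rcases h2 with _ | _ | ⟨J, hJ⟩
      · rw [form_symm]; exact form_letter_subst_mem x I (by omega)
      · rw [form_symm]; exact form_sq_subst_mem x n I
      · exact formMap_mem_treeSpan x
          (form_mem_small (by omega) (br_mem_deg I) (br_mem_deg J))
  | zero_left => rw [form_zero_left]; exact zero_mem _
  | zero_right => rw [map_zero]; exact zero_mem _
  | add_left _ _ _ _ _ _ h1 h2 => rw [form_add_left]; exact add_mem h1 h2
  | add_right _ _ _ _ _ _ h1 h2 => rw [map_add]; exact add_mem h1 h2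
  | neg_left _ _ _ _ h => rw [form_neg_left]; exact neg_mem h
  | neg_right _ _ _ _ h => rw [map_neg]; exact neg_mem h

/-! ### Detecting the exceptional trees in the one-letter algebra. -/

/-- The bracket of the free quasi-Lie algebra on one letter. -/
def oneLetter (a b : ℤ × ZMod 2) : ℤ × ZMod 2 := (0, a.1 * b.1)

theorem isQuasiLieBracket_oneLetter : IsQuasiLieBracket oneLetter where
  add_left a b c := by
    refine Prod.ext (add_zero _).symm ?_
    simp [oneLetter, add_mul]
  antisymm a b := by
    refine Prod.ext neg_zero.symm ?_
    simp only [oneLetter, Prod.snd_neg]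
    rw [CharTwo.neg_eq, mul_comm]
  jacobi a b c := by simp [oneLetter]

open Classical in
/-- The homomorphism killing all letters but `x`. -/
def toOneLetter : FreeQuasiLie α →+ ℤ × ZMod 2 :=
  lift isQuasiLieBracket_oneLetter fun a => if a = x then (1, 0) else 0

theorem toOneLetter_mul (p q : FreeQuasiLie α) :
    toOneLetter x (p * q) = oneLetter (toOneLetter x p) (toOneLetter x q) := lift_mul _ _ _ _

theorem toOneLetter_self : toOneLetter x (of x) = (1, 0) := by simp [toOneLetter]

theorem toOneLetter_other (a : α) (h : a ≠ x) : toOneLetter x (of a) = 0 := by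
  simp [toOneLetter, h]

theorem toOneLetter_sq : toOneLetter x (of x * of x) = (0, 1) := by
  simp [toOneLetter_mul, toOneLetter_self, oneLetter]

theorem toOneLetter_subst (q : FreeQuasiLie (Words x)) : toOneLetter x (subst x q) = 0 := by
  induction q using FreeQuasiLie.induction with
  | of w =>
    obtain ⟨i, y⟩ := w
    rw [subst_of]
    induction i with
    | zero => exact toOneLetter_other x y.1 y.2
    | succ i ih => rw [word_succ, toOneLetter_mul, ih, isQuasiLieBracket_oneLetter.zero_right]
  | zero => rw [map_zero, map_zero]
  | add p q hp hq => simp only [map_add, hp, hq, add_zero]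
  | neg p hp => simp only [map_neg, hp, neg_zero]
  | mul p q hp hq => rw [subst_mul, toOneLetter_mul, hp, isQuasiLieBracket_oneLetter.zero_left]

/-- Every word contains a letter other than `x`, so the contribution of trees in words is invisible
to `toOneLetter`. -/
theorem toOneLetter_legSubst (f : Legs (Words x)) (a : α) :
    toOneLetter x (legSubst x f a) = 0 := by
  classical
  rw [legSubst_apply, Finsupp.add_apply, map_add, Finsupp.single_apply]
  by_cases h : a = x
  · subst h
    rw [if_pos rfl, substEnds_apply_self, toOneLetter_subst, map_zero, add_zero]
  · rw [if_neg (Ne.symm h), substEnds_apply x _ ⟨a, h⟩, toOneLetter_subst, map_zero, add_zero]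

theorem toOneLetter_letters (f : α →₀ ℤ) : toOneLetter x (letters f) = (f x, 0) := by
  classical
  induction f using Finsupp.induction_linear with
  | zero => rw [map_zero, map_zero]; rfl
  | add f g hf hg => simp [hf, hg]
  | single a n =>
    rw [letters_single, map_zsmul]
    by_cases h : a = x
    · subst h
      simp [toOneLetter_self]
    · rw [toOneLetter_other x a h, Finsupp.single_eq_of_ne (Ne.symm h), smul_zero]
      rfl

theorem leafSum_letters (f : α →₀ ℤ) (q : FreeQuasiLie α) (a : α) :
    leafSum (letters f) q a = f a • q := by
  classical
  induction f using Finsupp.induction_linear with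
  | zero => simp
  | add f g hf hg => simp [hf, hg, add_smul]
  | single b n =>
    have h (m : ℤ) : leafSum (m • of b) q = m • Finsupp.single b q := by
      induction m with
      | zero => simp
      | succ i hi => rw [add_smul, leafSum_add, hi, one_smul, leafSum_of, add_smul, one_smul]
      | pred i hi =>
        rw [sub_smul, sub_eq_add_neg, leafSum_add, hi, one_smul, leafSum_neg, leafSum_of, sub_smul,
          one_smul, sub_eq_add_neg]
    rw [letters_single, h, Finsupp.smul_apply, Finsupp.single_apply, Finsupp.single_apply]
    split_ifs <;> simp

/-- Antisymmetry makes `[x, x]` two-torsion, so even coefficients contribute nothing. Parity is all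
that `toOneLetter` has to detect. -/
theorem form_sq_letters_eq_zero {g : α →₀ ℤ} (hg : ∀ a, (g a : ZMod 2) = 0) :
    form (of x * of x) (letters g) = 0 := by
  rw [letters, Finsupp.liftAddHom_apply, Finsupp.sum, map_sum]
  refine Finset.sum_eq_zero fun a _ => ?_
  obtain ⟨c, hc⟩ := (ZMod.intCast_zmod_eq_zero_iff_dvd _ _).1 (hg a)
  rw [hc, zmultiplesHom_apply, map_zsmul, mul_comm, mul_smul]
  have h : (2 : ℤ) • form (of x * of x) (of a) = 0 := by
    rw [two_smul, ← form_add_left, sq_add_sq, form_zero_left]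
  exact (congrArg (c • ·) h).trans (smul_zero c)

/-- Injectivity of `η` on trees in which `x` occurs, given injectivity on smaller trees. -/
theorem eq_zero_of_mem_treeSpan {n : ℕ}
    (ih : ∀ t : FormGroup (Words x), eta t = 0 → formProj (· < n) t = 0)
    {u : FormGroup α} (hu : u ∈ treeSpan x n) (h0 : eta u = 0) : u = 0 := by
  obtain ⟨_, ⟨t, ht, rfl⟩, _, hv, rfl⟩ := AddSubgroup.mem_sup.1 hu
  obtain ⟨_, ⟨f, rfl⟩, _, ⟨g, rfl⟩, rfl⟩ := AddSubgroup.mem_sup.1 hv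
  simp only [AddMonoidHom.comp_apply] at h0 ⊢
  -- One coordinate of `eta u = 0`, seen in the one-letter algebra. The word part dies, and the two
  -- rootings at the letters of `[x, x]` cancel by antisymmetry.
  have key (a : α) : toOneLetter x (Finsupp.single x (letters f) a) + (0, (g a : ZMod 2)) +
      f a • (1, 0) = 0 := by
    have h1 := congrArg (toOneLetter x) (DFunLike.congr_fun h0 a)
    rw [map_add, map_add, eta_formMap_word, eta_form, eta_form, leafSum_of, leafSum_mul,
      leafSum_of, antisymm (letters g) (of x), leafSum_of, Finsupp.single_neg, add_neg_cancel, zero_add,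
      Finsupp.add_apply, map_add, toOneLetter_legSubst, zero_add, Finsupp.add_apply,
      Finsupp.add_apply, leafSum_letters, leafSum_letters, map_add, map_add, map_zsmul, map_zsmul,
      toOneLetter_self, toOneLetter_sq, Finsupp.zero_apply, map_zero] at h1
    rw [← h1]
    simp only [zsmul_eq_mul]
    have : (g a : ℤ × ZMod 2) * (0, 1) = (0, (g a : ZMod 2)) := by
      ext <;> simp
    rw [this]
    abel
  have hf : f = 0 := by
    ext a
    have h1 := congrArg Prod.fst (key a)
    -- At `x` both ends of `⟨x, x⟩` contribute, giving `2 f(x) = 0` in `ℤ`; elsewhere `f(a)` appears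
    -- once.
    by_cases h : a = x
    · subst h
      simp [toOneLetter_letters] at h1
      simpa using h1
    · simpa [Finsupp.single_eq_of_ne h] using h1
  have hg : form (of x * of x) (letters g) = 0 := by
    refine form_sq_letters_eq_zero x fun a => ?_
    have h1 := congrArg Prod.snd (key a)
    simpa [hf] using h1
  rw [hf, hg, map_zero, map_zero, add_zero, add_zero] at h0 ⊢
  obtain ⟨s, hs⟩ := exists_eta_formDer x h0
  -- Since `s` is not known to be small, the conclusion is that `t` is the derivative of the
  -- truncation of `s`.
  have h2 := ih (t - formDer (fun w => of (shift x w)) s) (by rw [map_sub, hs, sub_self])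
  rw [map_sub, formProj_eq_self ht, formProj_formDer, sub_eq_zero] at h2
  rw [h2, formMap_formDer]

/-! ### Setting a letter to zero. -/

open Classical in
/-- The endomorphism of the alphabet killing the letter `x`. -/
def killLetter (a : α) : FreeQuasiLie α := if a = x then 0 else of a

/-- The endomorphism of the form group killing the letter `x`. -/
def kill : FormGroup α →+ FormGroup α := formMap (killLetter x)

/-- The dichotomy is whether `x` occurs in `I`. An occurrence of `x` is not counted as a word, which
gives the strict drop driving the induction. -/
theorem br_mem_splitSpan (I : FreeMagma α) :
    (br I ∈ splitSpan x I.length ∧ hom (killLetter x) (br I) = br I) ∨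
      ((∃ k, k < I.length ∧ br I ∈ splitSpan x k) ∧ hom (killLetter x) (br I) = 0) := by
  induction I with
  | ih1 a =>
    rw [br_of, hom_of, killLetter]
    by_cases h : a = x
    · rw [if_pos h, h]
      -- The letter `x` itself uses no words.
      exact Or.inr ⟨⟨0, Nat.zero_lt_one, AddSubgroup.subset_closure .letter⟩, rfl⟩
    · rw [if_neg h]
      refine Or.inl ⟨?_, rfl⟩
      have := SplitGen.subst (x := x) (k := 1) (FreeMagma.of (0, ⟨a, h⟩)) le_rfl
      rw [br_of, subst_of, word_zero] at this
      exact AddSubgroup.subset_closure this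
  | ih2 I J hI hJ =>
    rw [map_mul, hom_mul]
    change (_ ∈ splitSpan x (I.length + J.length) ∧ _) ∨ (∃ k, k < I.length + J.length ∧ _) ∧ _
    rcases hI with ⟨hI, eI⟩ | ⟨⟨k, hk, hI⟩, eI⟩
    · rcases hJ with ⟨hJ, eJ⟩ | ⟨⟨l, hl, hJ⟩, eJ⟩
      · exact Or.inl ⟨mul_mem_splitSpan x hI hJ, by rw [eI, eJ]⟩
      · exact Or.inr ⟨⟨_, by omega, mul_mem_splitSpan x hI hJ⟩, by rw [eJ, mul_zero]⟩
    · refine Or.inr ⟨?_, by rw [eI, zero_mul]⟩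
      rcases hJ with ⟨hJ, eJ⟩ | ⟨⟨l, hl, hJ⟩, eJ⟩
      · exact ⟨_, by omega, mul_mem_splitSpan x hI hJ⟩
      · exact ⟨_, by omega, mul_mem_splitSpan x hI hJ⟩

theorem kill_br (I J : FreeMagma α) :
    kill x (form (br I) (br J)) = form (br I) (br J) ∨
      (kill x (form (br I) (br J)) = 0 ∧
        ∃ k l, k + l < I.length + J.length ∧ br I ∈ splitSpan x k ∧ br J ∈ splitSpan x l) := by
  rw [kill, formMap_form]
  rcases br_mem_splitSpan x I with ⟨hI, eI⟩ | ⟨⟨k, hk, hI⟩, eI⟩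
  · rcases br_mem_splitSpan x J with ⟨hJ, eJ⟩ | ⟨⟨l, hl, hJ⟩, eJ⟩
    · exact Or.inl (by rw [eI, eJ])
    · exact Or.inr ⟨by rw [eJ, map_zero], _, _, by omega, hI, hJ⟩
  · refine Or.inr ⟨by rw [eI, form_zero_left], ?_⟩
    rcases br_mem_splitSpan x J with ⟨hJ, eJ⟩ | ⟨⟨l, hl, hJ⟩, eJ⟩
    · exact ⟨_, _, by omega, hI, hJ⟩
    · exact ⟨_, _, by omega, hI, hJ⟩

/-- The difference retains exactly the trees containing `x`, for which the bound on leaves improves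
by one when words are counted. -/
theorem sub_kill_mem {n : ℕ} {u : FormGroup α} (hu : u ∈ small α (n + 1)) :
    u - kill x u ∈ treeSpan x n := by
  induction hu using AddSubgroup.closure_induction with
  | mem _ h =>
    obtain ⟨I, J, h, rfl⟩ := h
    rcases kill_br x I J with e | ⟨e, k, l, hkl, hI, hJ⟩
    · rw [e, sub_self]; exact zero_mem _
    · rw [e, sub_zero]
      exact form_mem_treeSpan x (by omega) hI hJ
  | zero => rw [map_zero, sub_zero]; exact zero_mem _
  | add u v _ _ h1 h2 => rw [map_add, add_sub_add_comm]; exact add_mem h1 h2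
  | neg u _ h => rw [map_neg, neg_sub_neg, ← neg_sub]; exact neg_mem h

theorem eta_kill {t : FormGroup α} (ht : eta t = 0) : eta (kill x t) = 0 := by
  classical
  -- The operation on leaf sums induced by setting `x` to zero; it makes `eta` natural.
  let K : Legs α →+ Legs α := Finsupp.liftAddHom fun a =>
    if a = x then 0 else (Finsupp.singleAddHom a).comp (hom (killLetter x))
  have hK (p q : FreeQuasiLie α) :
      leafSum (hom (killLetter x) p) (hom (killLetter x) q) = K (leafSum p q) := by
    induction p using FreeQuasiLie.induction generalizing q with
    | of a =>
      rw [hom_of, leafSum_of, Finsupp.liftAddHom_apply_single, killLetter]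
      split_ifs
      · simp
      · simp
    | zero => simp
    | add p p' h h' => simp only [map_add, leafSum_add, h, h']
    | neg p h => simp only [map_neg, leafSum_neg, h]
    | mul p p' h h' => simp only [hom_mul, leafSum_mul, map_add, ← h, ← h']
  have h : eta.comp (kill x) = K.comp eta := formHom_ext fun p q => by
    simp only [AddMonoidHom.comp_apply, eta_form, map_add, ← hK]
    rfl
  have := DFunLike.congr_fun h t
  rwa [AddMonoidHom.comp_apply, AddMonoidHom.comp_apply, ht, map_zero] at this

end split

/-! ### The induction on the number of leaves. -/

section injectivity

variable {α : Type}

theorem foldr_kill_zero (l : List α) : l.foldr (fun a u => kill a u) 0 = 0 := by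
  induction l with
  | nil => rfl
  | cons a l ih => rw [List.foldr_cons, ih, map_zero]

theorem exists_kill_br (I J : FreeMagma α) : ∃ a, kill a (form (br I) (br J)) = 0 := by
  obtain ⟨a, ha⟩ : ∃ a, hom (killLetter a) (br I) = 0 := by
    induction I with
    | ih1 a => exact ⟨a, by simp [killLetter]⟩
    | ih2 I J hI _ =>
      obtain ⟨a, ha⟩ := hI
      exact ⟨a, by rw [map_mul, hom_mul, ha, zero_mul]⟩
  exact ⟨a, by rw [kill, formMap_form, ha, form_zero_left]⟩

/-- Killing a letter either fixes a tree or annihilates it, so a tree dies once the list contains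
one of its letters. Asking for all lists containing `s` makes the condition stable under sums. -/
theorem exists_foldr_kill {n : ℕ} {u : FormGroup α} (hu : u ∈ small α n) :
    ∃ s : Set α, s.Finite ∧
      ∀ l : List α, (∀ a ∈ s, a ∈ l) → l.foldr (fun a u => kill a u) u = 0 := by
  have hadd (l : List α) (u v : FormGroup α) : l.foldr (fun a u => kill a u) (u + v) =
      l.foldr (fun a u => kill a u) u + l.foldr (fun a u => kill a u) v := by
    induction l with
    | nil => rfl
    | cons a l ih => rw [List.foldr_cons, ih, map_add]; rfl
  induction hu using AddSubgroup.closure_induction with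
  | mem _ h =>
    obtain ⟨I, J, -, rfl⟩ := h
    obtain ⟨a, ha⟩ := exists_kill_br I J
    refine ⟨{a}, Set.finite_singleton a, fun l hl => ?_⟩
    have hl := hl a rfl
    have self_or (l : List α) :
        l.foldr (fun a u => kill a u) (form (br I) (br J)) = form (br I) (br J) ∨
          l.foldr (fun a u => kill a u) (form (br I) (br J)) = 0 := by
      induction l with
      | nil => exact Or.inl rfl
      | cons b l ih =>
        rw [List.foldr_cons]
        rcases ih with h | h
        · rw [h]
          exact (kill_br b I J).imp id And.left
        · rw [h, map_zero]
          exact Or.inr rfl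
    induction l with
    | nil => simp at hl
    | cons b l ih =>
      rw [List.foldr_cons]
      rcases List.mem_cons.1 hl with rfl | hl
      · rcases self_or l with h | h
        · rw [h, ha]
        · rw [h, map_zero]
      · rw [ih (by simpa using hl) hl, map_zero]
  | zero => exact ⟨∅, Set.finite_empty, fun l _ => foldr_kill_zero l⟩
  | add u v _ _ h1 h2 =>
    obtain ⟨s, hs, h1⟩ := h1
    obtain ⟨t, ht, h2⟩ := h2
    refine ⟨s ∪ t, hs.union ht, fun l hl => ?_⟩
    rw [hadd, h1 l fun a ha => hl a (Or.inl ha), h2 l fun a ha => hl a (Or.inr ha), add_zero]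
  | neg u _ h =>
    obtain ⟨s, hs, h⟩ := h
    refine ⟨s, hs, fun l hl => ?_⟩
    have := hadd l u (-u)
    rwa [add_neg_cancel, foldr_kill_zero, h l hl, zero_add, eq_comm] at this

/-- The alphabet is quantified inside the induction because the step for `α` uses the hypothesis for
`Words x`, which is infinite as soon as another letter exists. -/
theorem formProj_eq_zero (n : ℕ) : ∀ (α : Type) (t : FormGroup α), eta t = 0 →
    formProj (· < n) t = 0 := by
  induction n with
  | zero =>
    intro α t _
    suffices h : (formProj (· < 0) : FormGroup α →+ FormGroup α) = 0 from DFunLike.congr_fun h t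
    exact form_br_ext fun I J => by rw [formProj_br, if_neg (Nat.not_lt_zero _)]; rfl
  | succ n ih =>
    intro α t ht
    set u := formProj (· < n + 1) t with hu
    have hmem : u ∈ small α (n + 1) := formProj_mem_small t (n + 1)
    have heta : eta u = 0 := by rw [hu, eta_formProj, ht, map_zero]
    -- The part of `u` containing `x` lies in `ker eta` and has fewer words as leaves, so it
    -- vanishes.
    have hfix (x : α) : kill x u = u := by
      refine (sub_eq_zero.1 (eq_zero_of_mem_treeSpan x (ih _) (sub_kill_mem x hmem) ?_)).symm
      rw [map_sub, heta, eta_kill x heta, sub_zero]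
    obtain ⟨s, hs, h⟩ := exists_foldr_kill hmem
    rw [← h hs.toFinset.toList fun a ha => by simpa using ha]
    induction hs.toFinset.toList with
    | nil => rfl
    | cons a l ih => rw [List.foldr_cons, ← ih, hfix]

theorem eta_injective : Function.Injective (eta (α := α)) := by
  rw [injective_iff_map_eq_zero]
  intro t ht
  obtain ⟨n, hn⟩ := exists_mem_small t
  rw [← formProj_eq_self hn]
  exact formProj_eq_zero n α t ht

end injectivity

end FreeQuasiLie

/-! ### Comparison with the tree groups -/

open FreeQuasiLie

variable {m n : ℕ}

/-- The identification of the free quasi-Lie algebra on `m` generators with the one on the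
alphabet `Fin m`. -/
def toFree : QuasiLie m →+ FreeQuasiLie (Fin m) :=
  quotientLift (m := (· * ·)) (QuasiLieRel m) (FreeQuasiLie.mk (α := Fin m) : _ →+ _)
    (fun a b => map_mul FreeQuasiLie.mk a b) (by
      rintro _ _ (⟨a, b⟩ | ⟨a, b, c⟩)
      · simp only [AddMonoidHom.coe_coe, map_mul, map_neg]
        exact FreeQuasiLie.antisymm _ _
      · simp only [AddMonoidHom.coe_coe, map_mul, map_add, map_zero]
        exact FreeQuasiLie.jacobi _ _ _)

theorem toFree_gen (i : Fin m) : toFree (gen i) = of i := rfl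

theorem toFree_mul (x y : QuasiLie m) : toFree (x * y) = toFree x * toFree y := by
  obtain ⟨a, rfl⟩ := QuasiLie.mk_surjective x
  obtain ⟨b, rfl⟩ := QuasiLie.mk_surjective y
  exact map_mul FreeQuasiLie.mk a b

theorem toFree_bracketing (J : Rooted m) : toFree (bracketing J) = br J := by
  induction J using FreeMagma.recOnMul with
  | ih1 i => rfl
  | ih2 I J hI hJ => rw [map_mul, toFree_mul, hI, hJ, map_mul]

theorem isQuasiLieBracket_mul : IsQuasiLieBracket fun x y : QuasiLie m => x * y :=
  ⟨add_mul, mul_antisymm, jacobi⟩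

theorem toFree_injective : Function.Injective (toFree (m := m)) := by
  have hbr (J : Rooted m) : lift isQuasiLieBracket_mul gen (br J) = bracketing J := by
    induction J using FreeMagma.recOnMul with
    | ih1 i => exact lift_of _ _ _
    | ih2 I J hI hJ => rw [map_mul, lift_mul, hI, hJ, map_mul]
  refine Function.LeftInverse.injective (g := lift isQuasiLieBracket_mul gen) fun x => ?_
  obtain ⟨a, rfl⟩ := QuasiLie.mk_surjective x
  have h (a : FreeNonAssoc m) : lift isQuasiLieBracket_mul gen (FreeQuasiLie.mk a) =
      QuasiLie.mk a := by
    suffices h : (lift isQuasiLieBracket_mul gen).comp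
        (FreeQuasiLie.mk (α := Fin m)).toAddMonoidHom = (QuasiLie.mk (m := m)).toAddMonoidHom from
      DFunLike.congr_fun h a
    refine MonoidAlgebra.addHom_ext' fun J => ?_
    ext
    change lift isQuasiLieBracket_mul gen (FreeQuasiLie.mk (.single J 1)) =
      QuasiLie.mk (.single J 1)
    rw [mk_single, one_smul, hbr]
    induction J using FreeMagma.recOnMul with
    | ih1 i => rfl
    | ih2 I J hI hJ =>
      rw [map_mul, hI, hJ, ← map_mul, MonoidAlgebra.single_mul_single, mul_one]
  exact h a

variable (m n) in
/-- The map from the tree group to the universal form group. -/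
def toForm : TreeGroup m n →+ FormGroup (Fin m) :=
  QuotientAddGroup.lift _ (FreeAbelianGroup.lift fun t =>
    Quot.lift (fun p => form (br p.1) (br p.2)) (by
      rintro _ _ (⟨I, J⟩ | ⟨I, J, K⟩)
      · exact form_symm _ _
      · change form (br (I * J)) (br K) = form (br (J * K)) (br I)
        rw [map_mul, map_mul, form_mul, form_symm]) t.1) <| by
    rw [AddSubgroup.closure_le]
    rintro _ (⟨I, J, K, h, h'⟩ | ⟨A, B, C, D, hI, hH, hX⟩)
    · change FreeAbelianGroup.lift _ _ = 0
      rw [map_add, FreeAbelianGroup.lift_apply_of, FreeAbelianGroup.lift_apply_of]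
      exact isTreeForm_form.as I J K
    · change FreeAbelianGroup.lift _ _ = 0
      rw [map_add, map_sub, FreeAbelianGroup.lift_apply_of, FreeAbelianGroup.lift_apply_of,
        FreeAbelianGroup.lift_apply_of]
      exact isTreeForm_form.ihx A B C D

/-- The class of the tree `⟨I, J⟩` in the tree group. -/
def treeClass (I J : Rooted m) (h : (Tree.inner I J).order = n) : TreeGroup m n :=
  QuotientAddGroup.mk' _ (.of ⟨.inner I J, h⟩)

theorem toForm_treeClass (I J : Rooted m) (h : (Tree.inner I J).order = n) :
    toForm m n (treeClass I J h) = form (br I) (br J) :=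
  FreeAbelianGroup.lift_apply_of _ _

theorem treeGroup_hom_ext {G : Type*} [AddCommGroup G] {f g : TreeGroup m n →+ G}
    (H : ∀ I J h, f (treeClass I J h) = g (treeClass I J h)) : f = g := by
  refine QuotientAddGroup.addMonoidHom_ext _ (FreeAbelianGroup.lift_ext _ _ ?_)
  rintro ⟨⟨I, J⟩, h⟩
  exact H I J h

theorem order_inner (I J : Rooted m) :
    (Tree.inner I J).order = n ↔ I.length + J.length = n + 2 := by
  change Rooted.order I + Rooted.order J = n ↔ _
  rw [length_eq_order, length_eq_order]
  omega

variable (m n) in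
/-- The tree group element of a pair of bracketings, zero unless the tree has order `n`. -/
def treeOrZero (I J : Rooted m) : TreeGroup m n :=
  if h : (Tree.inner I J).order = n then treeClass I J h else 0

theorem treeOrZero_congr {I J K L : Rooted m} (h : Tree.inner I J = Tree.inner K L) :
    treeOrZero m n I J = treeOrZero m n K L := by
  simp only [treeOrZero, treeClass, h]

/-- Each relation involves trees of a single order, so sending the other orders to zero is
consistent. -/
theorem isTreeForm_treeOrZero : IsTreeForm (treeOrZero m n) where
  symm I J := treeOrZero_congr (Quot.sound (.flip I J))
  inv I J K := treeOrZero_congr ((Quot.sound (.move I J K)).trans (Quot.sound (.flip _ _)))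
  as I J K := by
    have e : (Tree.inner (I * J) K).order = n ↔ (Tree.inner (J * I) K).order = n := by
      rw [order_inner, order_inner]
      change I.length + J.length + _ = _ ↔ J.length + I.length + _ = _
      rw [add_comm I.length]
    by_cases h : (Tree.inner (I * J) K).order = n
    · rw [treeOrZero, treeOrZero, dif_pos h, dif_pos (e.1 h), treeClass, treeClass, ← map_add]
      exact (QuotientAddGroup.eq_zero_iff _).2 (AddSubgroup.subset_closure (.as I J K _ _))
    · rw [treeOrZero, treeOrZero, dif_neg h, dif_neg (mt e.2 h), add_zero]
  ihx A B C D := by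
    have e : (Tree.inner (A * (B * C)) D).order = n ↔ (Tree.inner (A * B * C) D).order = n := by
      rw [order_inner, order_inner]
      change A.length + (B.length + C.length) + _ = _ ↔ A.length + B.length + C.length + _ = _
      rw [← add_assoc A.length]
    have e' : (Tree.inner (A * (B * C)) D).order = n ↔ (Tree.inner (A * C * B) D).order = n := by
      rw [order_inner, order_inner]
      change A.length + (B.length + C.length) + _ = _ ↔ A.length + C.length + B.length + _ = _
      rw [← add_assoc A.length, add_right_comm A.length]
    by_cases h : (Tree.inner (A * (B * C)) D).order = n
    · rw [treeOrZero, treeOrZero, treeOrZero, dif_pos h, dif_pos (e.1 h), dif_pos (e'.1 h),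
        treeClass, treeClass, treeClass, ← map_sub, ← map_add]
      exact (QuotientAddGroup.eq_zero_iff _).2 (AddSubgroup.subset_closure (.ihx A B C D _ _ _))
    · rw [treeOrZero, treeOrZero, treeOrZero, dif_neg h, dif_neg (mt e.2 h), dif_neg (mt e'.2 h),
        add_zero, sub_zero]

variable (m n) in
/-- The map from the universal form group to the group of trees of order `n`. -/
def ofForm : FormGroup (Fin m) →+ TreeGroup m n := treeFormLift isTreeForm_treeOrZero

theorem ofForm_br (I J : Rooted m) : ofForm m n (form (br I) (br J)) = treeOrZero m n I J :=
  treeFormLift_br _ _ _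

theorem ofForm_toForm (t : TreeGroup m n) : ofForm m n (toForm m n t) = t := by
  suffices h : (ofForm m n).comp (toForm m n) = AddMonoidHom.id _ from DFunLike.congr_fun h t
  refine treeGroup_hom_ext fun I J h => ?_
  rw [AddMonoidHom.comp_apply, toForm_treeClass, ofForm_br, treeOrZero, dif_pos h]
  rfl

/-- With `ofForm_toForm`, this exhibits the tree group as the direct summand of trees with `n + 2`
leaves, that is, `n` trivalent vertices. -/
theorem toForm_ofForm (s : FormGroup (Fin m)) :
    toForm m n (ofForm m n s) = formProj (· = n + 2) s := by
  suffices h : (toForm m n).comp (ofForm m n) = formProj (· = n + 2) from DFunLike.congr_fun h s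
  refine form_br_ext fun I J => ?_
  rw [AddMonoidHom.comp_apply, ofForm_br, formProj_br, treeOrZero]
  by_cases h : (Tree.inner I J).order = n
  · rw [dif_pos h, if_pos ((order_inner I J).1 h), toForm_treeClass]
  · rw [dif_neg h, if_neg (mt (order_inner I J).2 h), map_zero]

/-! ### Embedding the target tensor product in `ℤ^m ⊗ L'`. -/

/-- The class of an element of the free quasi-Lie algebra modulo brackets. -/
def abelianize {α : Type} : FreeQuasiLie α →+ (α →₀ ℤ) :=
  lift (m := fun _ _ => 0)
    ⟨fun _ _ _ => (add_zero _).symm, fun _ _ => neg_zero.symm, fun _ _ _ => by simp⟩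
    fun a => Finsupp.single a 1

@[simp] theorem abelianize_of {α : Type} (a : α) :
    abelianize (of a) = Finsupp.single a 1 := lift_of _ _ _

/-- The generators as elements of degree one. -/
def letterDeg (i : Fin m) : QuasiLieDeg m 1 := bracketingDeg (FreeMagma.of i) rfl

variable (m n) in
/-- The embedding of `L'_1 ⊗ L'_{n+1}` in `ℤ^m ⊗ L'`. -/
def tensorLegs : QuasiLieDeg m 1 ⊗[ℤ] QuasiLieDeg m (n + 1) →+ Legs (Fin m) :=
  TensorProduct.liftAddHom
    (AddMonoidHom.mk' (fun x => (leafSum (letters (abelianize (toFree (x : QuasiLie m))))).comp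
      (toFree.comp (QuasiLieDeg m (n + 1)).subtype.toAddMonoidHom)) fun x y => by
        ext z : 1
        simp)
    fun r x y => by
      rw [map_zsmul, map_zsmul]
      rfl

theorem tensorLegs_tmul (i : Fin m) (y : QuasiLieDeg m (n + 1)) :
    tensorLegs m n (letterDeg i ⊗ₜ y) =
      Finsupp.single i (toFree (y : QuasiLie m)) := by
  change leafSum (letters (abelianize (of i))) (toFree (y : QuasiLie m)) = _
  rw [abelianize_of, letters_single, one_smul, leafSum_of]

variable (m n) in
/-- The map `ℤ^m ⊗ L'_{n+1} → L'_1 ⊗ L'_{n+1}`. -/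
def legsTensor : (Fin m →₀ QuasiLieDeg m (n + 1)) →+ QuasiLieDeg m 1 ⊗[ℤ] QuasiLieDeg m (n + 1) :=
  Finsupp.liftAddHom fun i =>
    (TensorProduct.mk ℤ _ _ (letterDeg i)).toAddMonoidHom

theorem legsTensor_single (i : Fin m) (y : QuasiLieDeg m (n + 1)) :
    legsTensor m n (Finsupp.single i y) = letterDeg i ⊗ₜ y :=
  Finsupp.liftAddHom_apply_single _ _ _

/-- A bracketing of length one is a letter, so the letters span the first tensor factor. -/
theorem legsTensor_surjective : Function.Surjective (legsTensor m n) := by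
  rw [← AddMonoidHom.range_eq_top, eq_top_iff]
  rintro z -
  induction z using TensorProduct.induction_on with
  | zero => exact zero_mem _
  | add x y hx hy => exact add_mem hx hy
  | tmul x y =>
    obtain ⟨x, hx⟩ := x
    induction hx using Submodule.span_induction with
    | mem x h =>
      obtain ⟨J, hJ, rfl⟩ := h
      cases J with
      | of i => exact ⟨Finsupp.single i y, legsTensor_single i y⟩
      | mul I J =>
        have h1 := I.length_pos
        have h2 := J.length_pos
        have h3 : I.length + J.length = 1 := hJ
        omega
    | zero =>
      change (0 : QuasiLieDeg m 1) ⊗ₜ[ℤ] y ∈ _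
      rw [TensorProduct.zero_tmul]
      exact zero_mem _
    | add a b ha hb h1 h2 =>
      change ((⟨a, ha⟩ : QuasiLieDeg m 1) + ⟨b, hb⟩) ⊗ₜ[ℤ] y ∈ _
      rw [TensorProduct.add_tmul]
      exact add_mem h1 h2
    | smul c a ha h =>
      change (c • (⟨a, ha⟩ : QuasiLieDeg m 1)) ⊗ₜ[ℤ] y ∈ _
      rw [← TensorProduct.smul_tmul']
      exact zsmul_mem h c

theorem tensorLegs_legsTensor_apply (f : Fin m →₀ QuasiLieDeg m (n + 1)) (i : Fin m) :
    tensorLegs m n (legsTensor m n f) i = toFree (f i : QuasiLie m) := by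
  induction f using Finsupp.induction_linear with
  | zero => simp
  | add f g hf hg => simp only [map_add, Finsupp.add_apply, hf, hg, Submodule.coe_add]
  | single j y =>
    rw [legsTensor_single, tensorLegs_tmul, Finsupp.single_apply, Finsupp.single_apply]
    split_ifs <;> simp

/-- The composite with the surjection `legsTensor` is `toFree` in each coordinate, hence injective.
-/
theorem tensorLegs_injective : Function.Injective (tensorLegs m n) := by
  rw [injective_iff_map_eq_zero]
  intro z hz
  obtain ⟨f, rfl⟩ := legsTensor_surjective z
  have h : f = 0 := by
    ext i
    have := tensorLegs_legsTensor_apply f i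
    rw [hz] at this
    exact toFree_injective (this.symm.trans (map_zero _).symm)
  rw [h, map_zero]

theorem proj_toFree {k : ℕ} {y : QuasiLie m} (hy : y ∈ QuasiLieDeg m k) :
    proj (· = k) (toFree y) = toFree y := by
  induction hy using Submodule.span_induction with
  | mem x h =>
    obtain ⟨J, hJ, rfl⟩ := h
    rw [toFree_bracketing, proj_br, if_pos hJ]
  | zero => simp
  | add a b _ _ h1 h2 => rw [map_add, map_add, h1, h2]
  | smul c a _ h => rw [map_zsmul, map_zsmul, h]

theorem legProj_tensorLegs (z : QuasiLieDeg m 1 ⊗[ℤ] QuasiLieDeg m (n + 1)) :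
    legProj (· = n + 1) (tensorLegs m n z) = tensorLegs m n z := by
  obtain ⟨f, rfl⟩ := legsTensor_surjective z
  ext i
  change proj _ (tensorLegs m n (legsTensor m n f) i) = _
  rw [tensorLegs_legsTensor_apply, proj_toFree (f i).2]

theorem legBr_tensorLegs (z : QuasiLieDeg m 1 ⊗[ℤ] QuasiLieDeg m (n + 1)) :
    legBr (tensorLegs m n z) = toFree (bracketMap m n z : QuasiLie m) := by
  obtain ⟨f, rfl⟩ := legsTensor_surjective z
  induction f using Finsupp.induction_linear with
  | zero => simp
  | add f g hf hg => simp only [map_add, hf, hg, Submodule.coe_add]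
  | single i y =>
    rw [legsTensor_single, tensorLegs_tmul, legBr_single, ← toFree_gen, ← toFree_mul]
    rfl

theorem tensorLegs_etaAux (I : Rooted m) {k : ℕ} (hk : Rooted.order I + k = n + 1)
    {c : QuasiLie m} (hc : c ∈ QuasiLieDeg m k) :
    tensorLegs m n (etaAux n I c) = leafSum (br I) (toFree c) := by
  induction I using FreeMagma.recOnMul generalizing k c with
  | ih1 i =>
    obtain rfl : k = n + 1 := by rw [← hk]; exact (Nat.zero_add k).symm
    change tensorLegs m n (tmulAux n i c) = _
    rw [tmulAux, dif_pos hc, br_of, leafSum_of]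
    exact tensorLegs_tmul i ⟨c, hc⟩
  | ih2 I J hI hJ =>
    change Rooted.order I + Rooted.order J + 1 + k = n + 1 at hk
    have h1 := length_eq_order I
    have h2 := length_eq_order J
    rw [etaAux_mul, map_add, hI (k := J.length + k) (by omega)
        (LevineConj.mul_mem_deg (bracketing_mem J rfl) hc),
      hJ (k := k + I.length) (by omega) (LevineConj.mul_mem_deg hc (bracketing_mem I rfl)),
      map_mul br, leafSum_mul, toFree_mul, toFree_mul, toFree_bracketing, toFree_bracketing]

/-- The square relating Levine's map to `eta`; it transports both injectivity and exactness. -/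
theorem tensorLegs_etaPrime (t : TreeGroup m n) :
    tensorLegs m n (etaPrime m n t) = eta (toForm m n t) := by
  suffices h : (tensorLegs m n).comp
      ((BracketKernel m n).subtype.toAddMonoidHom.comp (etaPrime m n)) =
        eta.comp (toForm m n) from DFunLike.congr_fun h t
  refine treeGroup_hom_ext fun I J h => ?_
  have h' : Rooted.order I + Rooted.order J = n := h
  have h1 := length_eq_order I
  have h2 := length_eq_order J
  change tensorLegs m n (etaPrime m n (QuotientAddGroup.mk (.of ⟨.inner I J, h⟩))) = _
  rw [etaPrime_of, etaTree_eq, map_add, tensorLegs_etaAux I (by omega) (bracketing_mem J rfl),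
    tensorLegs_etaAux J (by omega) (bracketing_mem I rfl), toFree_bracketing, toFree_bracketing,
    AddMonoidHom.comp_apply, toForm_treeClass, eta_form]

theorem etaPrime_injective : Function.Injective (etaPrime m n) := by
  intro s t h
  have h' : eta (toForm m n s) = eta (toForm m n t) := by
    rw [← tensorLegs_etaPrime, ← tensorLegs_etaPrime, h]
  rw [← ofForm_toForm s, eta_injective h', ofForm_toForm]

theorem etaPrime_surjective : Function.Surjective (etaPrime m n) := by
  rintro ⟨z, hz⟩
  have h : legBr (tensorLegs m n z) = 0 := by
    rw [legBr_tensorLegs, LinearMap.mem_ker.1 hz]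
    exact map_zero _
  obtain ⟨s, hs⟩ := exists_eta_eq h
  -- The preimage `s` may have components of other orders. Discarding them does not change `eta s`
  -- in degree `n + 1`, where all of `tensorLegs m n z` lies.
  refine ⟨ofForm m n s, Subtype.ext (tensorLegs_injective ?_)⟩
  rw [tensorLegs_etaPrime, toForm_ofForm, eta_formProj, hs, ← legProj_tensorLegs z]
  simp only [Nat.add_right_cancel_iff, legProj_tensorLegs]
end LevineConj
end

theorem mainTheorem4 (m n : ℕ) : Function.Bijective (LevineConj.etaPrime m n) :=
  ⟨LevineConj.etaPrime_injective, LevineConj.etaPrime_surjective⟩
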